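/- All graphs are finite and simple. A star edge coloring of a graph $G$ is a proper edge coloring of $G$ in which no path with four edges and no cycle with four edges is colored with at most two colors. The star chromatic index $\chi'_{st}(G)$ is the least number of colors in a star edge coloring of $G$. A Halin graph is a graph $G = T \cup C$, where $T$ is a tree with at least four vertices and no vertex of degree two, embedded in the plane, and $C$ is the cycle that joins the leaves of $T$ in their cyclic order around the embedded tree. **Theorem.** If $G$ is a cubic (that is, $3$-regular) Halin graph, then $\chi'_{st}(G) \leq 6$. This bound is sharp: the complement $\overline{C_6}$ of the $6$-cycle is a cubic Halin graph with $\chi'_{st}(\overline{C_6}) = 6$. -/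

import Mathlib

namespace SimpleGraph

/-- An edge coloring is proper if distinct edges with a common endpoint have distinct colors. -/
def EdgeLabeling.IsProper {V K : Type*} {G : SimpleGraph V} (f : G.EdgeLabeling K) : Prop :=
  ∀ e e' : G.edgeSet, e ≠ e' → (∃ v : V, v ∈ (e : Sym2 V) ∧ v ∈ (e' : Sym2 V)) → f e ≠ f e'

/-- The edges of the walk `p` have at most two colors altogether. -/
def EdgeLabeling.IsTwoColored {V K : Type*} {G : SimpleGraph V} (f : G.EdgeLabeling K)
    {u v : V} (p : G.Walk u v) : Prop :=
  ∃ a b : K, ∀ e : G.edgeSet, (e : Sym2 V) ∈ p.edges → f e = a ∨ f e = b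

/-- A star edge coloring: a proper edge coloring with no two-colored path of length four and no
two-colored cycle of length four (length is the number of edges). -/
structure EdgeLabeling.IsStar {V K : Type*} {G : SimpleGraph V} (f : G.EdgeLabeling K) : Prop where
  proper : f.IsProper
  path : ∀ (u v : V) (p : G.Walk u v), p.IsPath → p.length = 4 → ¬ f.IsTwoColored p
  cycle : ∀ (u : V) (p : G.Walk u u), p.IsCycle → p.length = 4 → ¬ f.IsTwoColored p

/-- The star chromatic index: the least number of colors in a star edge coloring
(`⊤` if no finite number of colors suffices). -/
noncomputable def starChromaticIndex {V : Type*} (G : SimpleGraph V) : ℕ∞ :=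
  ⨅ t ∈ {t : ℕ | ∃ f : G.EdgeLabeling (Fin t), f.IsStar}, (t : ℕ∞)

/-- `v` is a leaf (pendant vertex): it has exactly one neighbor. -/
def IsLeaf {V : Type*} (T : SimpleGraph V) (v : V) : Prop :=
  (T.neighborSet v).ncard = 1

/-- A rotation system: at every vertex, a cyclic order of the darts (oriented edges) that leave it.
For a finite tree `T`, this is the same as an embedding of `T` in the oriented plane, up to
orientation-preserving homeomorphism. -/
structure RotationSystem {V : Type*} (T : SimpleGraph V) where
  /-- the next dart around the common initial vertex -/
  rot : Equiv.Perm T.Dart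
  fst_rot : ∀ d : T.Dart, (rot d).fst = d.fst
  sameCycle : ∀ d d' : T.Dart, d.fst = d'.fst → rot.SameCycle d d'

namespace RotationSystem

variable {V : Type*} {T : SimpleGraph V}

/-- One step of the walk along the boundary of a face: having traversed the dart `d`, continue with
the dart that follows the reversal of `d` in the rotation at the head of `d`. For a plane tree, this
is the closed walk around the tree, along the boundary of its only face. -/
def faceStep (R : RotationSystem T) (d : T.Dart) : T.Dart :=
  R.rot d.symm

/-- `y` is the next leaf after the leaf `x` on the boundary walk: starting with a dart that leaves
`x`, the walk reaches `y` after finitely many steps, with no leaf strictly in between. -/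
def IsNextLeaf (R : RotationSystem T) (x y : V) : Prop :=
  T.IsLeaf x ∧ T.IsLeaf y ∧ ∃ (d : T.Dart) (n : ℕ), d.fst = x ∧ (R.faceStep^[n] d).snd = y ∧
    ∀ i < n, ¬ T.IsLeaf (R.faceStep^[i] d).snd

/-- The adjoint cycle, which joins the leaves of the plane tree in their order around the tree. -/
def leafCycle (R : RotationSystem T) : SimpleGraph V :=
  SimpleGraph.fromRel R.IsNextLeaf

end RotationSystem

/-- A Halin graph: the union of a plane tree on at least four vertices, without vertices of
degree two, and the cycle through its leaves in the order given by the plane embedding. -/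
def IsHalin {V : Type*} [Finite V] (G : SimpleGraph V) : Prop :=
  4 ≤ Nat.card V ∧ ∃ (T : SimpleGraph V) (R : RotationSystem T),
    T.IsTree ∧ (∀ v : V, (T.neighborSet v).ncard ≠ 2) ∧ G = T ⊔ R.leafCycle

end SimpleGraph

/-! In a proper coloring, a path or cycle with four edges is two-colored exactly when, at its middle
vertex, the color of each middle edge recurs at the far end of the other. In a cubic graph the star
condition is thus a check at each vertex, on its three colors and those at the far ends of its edges
(`VertexOK`, `exists_isStar`).

Root the tree at a leaf `x`. What remains is a plane binary tree with a path through its leaves, and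
every subtree is joined to the rest of the graph by only three edges: one at its root, one at its
first leaf, one at its last leaf. What the outside must know about a coloring of the subtree is
bounded data at these edges, an `Interface`. Six colors suffice by a finite fact: leaves, cherries
and larger trees have short lists of interfaces (`reps`) such that every interface listed for a
compound tree is glued from recolored listed interfaces of its two subtrees (`exists_glue`). By
induction every tree realizes the whole list of its kind (`realizes_of_mem_reps`), and some entry
can be closed up at `x` (`exists_closes`).

The boundary walk of the plane tree visits the leaves in the order of the binary tree, so the
colored binary tree describes the Halin graph itself. For sharpness, an exhaustive search excludes
five colors on the triangular prism, which is the complement of the 6-cycle. -/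

namespace HalinColoring

/-! ### Colored binary trees and the local star condition -/

/-- Shapes of plane binary trees. -/
inductive BinTree
  | leaf
  | node (t₁ t₂ : BinTree)

/-- A plane binary tree that hangs on an edge, with colors: at each branching, `a` and `b` are the
colors of the edges to the left and to the right subtree, and `m` is the color of the edge that joins
the last leaf of the left subtree to the first leaf of the right subtree. -/
inductive ColTree (K : Type*)
  | leaf
  | node (a b m : K) (t₁ t₂ : ColTree K)

namespace ColTree

variable {K : Type*}

/-- The underlying binary tree. -/
def shape : ColTree K → BinTree
  | leaf => .leaf
  | node _ _ _ t₁ t₂ => .node t₁.shape t₂.shape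

/-- Recoloring. -/
def map {K' : Type*} (σ : K → K') : ColTree K → ColTree K'
  | leaf => leaf
  | node a b m t₁ t₂ => node (σ a) (σ b) (σ m) (t₁.map σ) (t₂.map σ)

/-- Colors at the root, apart from that of the edge on which the tree hangs; `l` and `r` are the
colors of the cycle edges that enter the first leaf and leave the last one. -/
def rootColors : ColTree K → K → K → List K
  | leaf, l, r => [l, r]
  | node a b _ _ _, _, _ => [a, b]

/-- Colors at the first leaf, apart from that of the cycle edge that enters it. -/
def leftColors : ColTree K → K → K → List K
  | leaf, p, r => [p, r]
  | node a _ m t₁ _, _, _ => t₁.leftColors a m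

/-- Colors at the last leaf, apart from that of the cycle edge that leaves it. -/
def rightColors : ColTree K → K → K → List K
  | leaf, p, l => [p, l]
  | node _ b m _ t₂, _, _ => t₂.rightColors b m

end ColTree

/-- The condition at a vertex for a star coloring: its edges have distinct colors `x`, `y`, `z`, and,
given the other colors `X`, `Y`, `Z` at their far ends, it is not the middle vertex of a two-colored
path or cycle with four edges. -/
def VertexOK {K : Type*} (x y z : K) (X Y Z : List K) : Prop :=
  (x ≠ y ∧ x ≠ z ∧ y ≠ z) ∧ ¬ (y ∈ X ∧ x ∈ Y) ∧ ¬ (z ∈ X ∧ x ∈ Z) ∧ ¬ (z ∈ Y ∧ y ∈ Z)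

instance {K : Type*} [DecidableEq K] (x y z : K) (X Y Z : List K) :
    Decidable (VertexOK x y z X Y Z) := by
  unfold VertexOK; infer_instance

/-- Fewer far colors mean fewer conflicts; hence an interface need only record supersets of the
colors at its inner ends. -/
theorem VertexOK.anti {K : Type*} {x y z : K} {X Y Z X' Y' Z' : List K}
    (h : VertexOK x y z X' Y' Z') (hX : X ⊆ X') (hY : Y ⊆ Y') (hZ : Z ⊆ Z') :
    VertexOK x y z X Y Z :=
  ⟨h.1, fun e => h.2.1 ⟨hX e.1, hY e.2⟩, fun e => h.2.2.1 ⟨hX e.1, hZ e.2⟩,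
    fun e => h.2.2.2 ⟨hY e.1, hZ e.2⟩⟩

theorem VertexOK.map {K K' : Type*} {σ : K → K'} (hσ : Function.Injective σ) {x y z : K}
    {X Y Z : List K} :
    VertexOK (σ x) (σ y) (σ z) (X.map σ) (Y.map σ) (Z.map σ) ↔ VertexOK x y z X Y Z := by
  simp only [VertexOK, List.mem_map_of_injective hσ, hσ.ne_iff]

namespace ColTree

variable {K : Type*}

/-- All vertices of the tree satisfy `VertexOK`, where `P`, `L`, `R` are the colors at the outer ends
of the three edges of colors `p`, `l`, `r` that join the tree to the rest of the graph. -/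
def Valid : ColTree K → List K → List K → List K → K → K → K → Prop
  | leaf, P, L, R, p, l, r => VertexOK p l r P L R
  | node a b m t₁ t₂, P, L, R, p, l, r =>
    VertexOK p a b P (t₁.rootColors l m) (t₂.rootColors m r) ∧
    t₁.Valid [p, b] L (t₂.leftColors b r) a l m ∧ t₂.Valid [p, a] (t₁.rightColors a l) R b m r

variable {K' : Type*} (σ : K → K')

theorem shape_map (t : ColTree K) : (t.map σ).shape = t.shape := by
  induction t with
  | leaf => rfl
  | node a b m t₁ t₂ ih₁ ih₂ => simp [map, shape, ih₁, ih₂]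

theorem rootColors_map (t : ColTree K) (l r : K) :
    (t.map σ).rootColors (σ l) (σ r) = (t.rootColors l r).map σ := by
  cases t <;> rfl

theorem leftColors_map (t : ColTree K) (p r : K) :
    (t.map σ).leftColors (σ p) (σ r) = (t.leftColors p r).map σ := by
  induction t generalizing p r with
  | leaf => rfl
  | node a b m t₁ t₂ ih₁ ih₂ => exact ih₁ a m

theorem rightColors_map (t : ColTree K) (p l : K) :
    (t.map σ).rightColors (σ p) (σ l) = (t.rightColors p l).map σ := by
  induction t generalizing p l with
  | leaf => rfl
  | node a b m t₁ t₂ ih₁ ih₂ => exact ih₂ b m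

variable {σ}

theorem Valid.map (hσ : Function.Injective σ) {t : ColTree K} {P L R : List K} {p l r : K}
    (h : t.Valid P L R p l r) :
    (t.map σ).Valid (P.map σ) (L.map σ) (R.map σ) (σ p) (σ l) (σ r) := by
  induction t generalizing P L R p l r with
  | leaf => exact (VertexOK.map hσ).2 h
  | node a b m t₁ t₂ ih₁ ih₂ =>
    refine ⟨?_, ?_, ?_⟩
    · rw [rootColors_map, rootColors_map]
      exact (VertexOK.map hσ).2 h.1
    · rw [leftColors_map]
      exact ih₁ h.2.1
    · rw [rightColors_map]
      exact ih₂ h.2.2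

end ColTree

/-! ### Interfaces: gluing, closing, recoloring -/

/-- What is known at the inner end of an edge that joins a tree to the rest of the graph: the color
of the edge, a list of colors containing the other colors at the inner end, and a list of colors that
must be absent from the outer end. -/
structure Port (K : Type*) where
  color : K
  inner : List K
  avoid : List K

/-- The ports of a tree: at the root, at the first leaf, and at the last leaf. -/
structure Interface (K : Type*) where
  p : Port K
  l : Port K
  r : Port K

def Port.map {K K' : Type*} (σ : K → K') (x : Port K) : Port K' :=
  ⟨σ x.color, x.inner.map σ, x.avoid.map σ⟩

def Interface.map {K K' : Type*} (σ : K → K') (s : Interface K) : Interface K' :=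
  ⟨s.p.map σ, s.l.map σ, s.r.map σ⟩

/-- The binary tree `t` has a coloring with the interface `s`. -/
def Realizes {K : Type*} (t : BinTree) (s : Interface K) : Prop :=
  ∃ T : ColTree K, T.shape = t ∧ T.rootColors s.l.color s.r.color ⊆ s.p.inner ∧
    T.leftColors s.p.color s.r.color ⊆ s.l.inner ∧ T.rightColors s.p.color s.l.color ⊆ s.r.inner ∧
    ∀ P L R : List K, P.Disjoint s.p.avoid → L.Disjoint s.l.avoid → R.Disjoint s.r.avoid →
      T.Valid P L R s.p.color s.l.color s.r.color

/-- The single leaf has a coloring with the interface `s`. -/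
def LeafOK {K : Type*} (s : Interface K) : Prop :=
  (s.p.color ≠ s.l.color ∧ s.p.color ≠ s.r.color ∧ s.l.color ≠ s.r.color) ∧
  ([s.l.color, s.r.color] ⊆ s.p.inner ∧ [s.p.color, s.r.color] ⊆ s.l.inner ∧
    [s.p.color, s.l.color] ⊆ s.r.inner) ∧
  (s.l.color ∈ s.p.avoid ∨ s.p.color ∈ s.l.avoid) ∧
  (s.r.color ∈ s.p.avoid ∨ s.p.color ∈ s.r.avoid) ∧
  (s.r.color ∈ s.l.avoid ∨ s.l.color ∈ s.r.avoid)

/-- Trees with the interfaces `s₁` and `s₂` can be joined to a tree with the interface `s`. -/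
def Glue {K : Type*} (s₁ s₂ s : Interface K) : Prop :=
  (s₁.l.color = s.l.color ∧ s₁.r.color = s₂.l.color ∧ s₂.r.color = s.r.color) ∧
  (s.p.color ≠ s₁.p.color ∧ s.p.color ≠ s₂.p.color ∧ s₁.p.color ≠ s₂.p.color) ∧
  ([s₁.p.color, s₂.p.color] ⊆ s.p.inner ∧ s₁.l.inner ⊆ s.l.inner ∧ s₂.r.inner ⊆ s.r.inner) ∧
  ((s.p.color ∈ s₁.p.inner → s₁.p.color ∈ s.p.avoid) ∧
    (s.p.color ∈ s₂.p.inner → s₂.p.color ∈ s.p.avoid) ∧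
    ¬ (s₂.p.color ∈ s₁.p.inner ∧ s₁.p.color ∈ s₂.p.inner)) ∧
  (List.Disjoint [s.p.color, s₂.p.color] s₁.p.avoid ∧
    List.Disjoint [s.p.color, s₁.p.color] s₂.p.avoid) ∧
  (s₁.l.avoid ⊆ s.l.avoid ∧ s₂.r.avoid ⊆ s.r.avoid) ∧
  s₂.l.inner.Disjoint s₁.r.avoid ∧ s₁.r.inner.Disjoint s₂.l.avoid

/-- A tree with the interface `s` can be joined to a leaf, along all three edges. -/
def Closes {K : Type*} (s : Interface K) : Prop :=
  VertexOK s.p.color s.l.color s.r.color s.p.inner s.l.inner s.r.inner ∧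
  List.Disjoint [s.l.color, s.r.color] s.p.avoid ∧ List.Disjoint [s.p.color, s.r.color] s.l.avoid ∧
  List.Disjoint [s.p.color, s.l.color] s.r.avoid

/-- Each of the three pairs of edges at a leaf is kept from alternating by banning one color at one
of the two outer ends. -/
theorem realizes_leaf {K : Type*} {s : Interface K} (h : LeafOK s) : Realizes .leaf s := by
  obtain ⟨h1, h2, h3, h4, h5⟩ := h
  refine ⟨.leaf, rfl, h2.1, h2.2.1, h2.2.2, fun P L R hP hL hR => ⟨h1, ?_, ?_, ?_⟩⟩
  · rintro ⟨a, b⟩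
    exact h3.elim (hP a) (hL b)
  · rintro ⟨a, b⟩
    exact h4.elim (hP a) (hR b)
  · rintro ⟨a, b⟩
    exact h5.elim (hL a) (hR b)

/-- Every ban of a subtree is either met inside, by the new root or by the other subtree across the
middle cycle edge, or handed on to the outside. The new root may add bans at the root port. -/
theorem realizes_node {K : Type*} {t₁ t₂ : BinTree} {s₁ s₂ s : Interface K} (h₁ : Realizes t₁ s₁)
    (h₂ : Realizes t₂ s₂) (h : Glue s₁ s₂ s) : Realizes (.node t₁ t₂) s := by
  obtain ⟨T₁, hT₁, p₁, l₁, r₁, v₁⟩ := h₁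
  obtain ⟨T₂, hT₂, p₂, l₂, r₂, v₂⟩ := h₂
  obtain ⟨⟨hl, hm, hr⟩, hne, ⟨hp, hl', hr'⟩, ⟨ha, hb, hab⟩, ⟨d₁, d₂⟩, ⟨e₁, e₂⟩, f₁, f₂⟩ := h
  rw [← hm] at p₂ r₂ v₂
  rw [hl] at p₁ r₁ v₁
  rw [hr] at p₂ l₂ v₂
  refine ⟨.node s₁.p.color s₂.p.color s₁.r.color T₁ T₂, by simp [ColTree.shape, hT₁, hT₂], hp,
    fun _ h => hl' (l₁ h), fun _ h => hr' (r₂ h), fun P L R hP hL hR => ⟨⟨hne, ?_, ?_, ?_⟩, ?_, ?_⟩⟩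
  · rintro ⟨a, b⟩
    exact hP a (ha (p₁ b))
  · rintro ⟨a, b⟩
    exact hP a (hb (p₂ b))
  · rintro ⟨a, b⟩
    exact hab ⟨p₁ a, p₂ b⟩
  · exact v₁ _ _ _ d₁ (fun x hx hx' => hL hx (e₁ hx')) fun x hx hx' => f₁ (l₂ hx) hx'
  · exact v₂ _ _ _ d₂ (fun x hx hx' => f₂ (r₁ hx) hx') (fun x hx hx' => hR hx (e₂ hx'))

theorem Realizes.closes {K : Type*} {t : BinTree} {s : Interface K} (h : Realizes t s)
    (hs : Closes s) : ∃ (T : ColTree K) (p l r : K), T.shape = t ∧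
      T.Valid [l, r] [p, r] [p, l] p l r ∧
      VertexOK p l r (T.rootColors l r) (T.leftColors p r) (T.rightColors p l) := by
  obtain ⟨T, hT, hp, hl, hr, hv⟩ := h
  exact ⟨T, s.p.color, s.l.color, s.r.color, hT, hv _ _ _ hs.2.1 hs.2.2.1 hs.2.2.2,
    hs.1.anti hp hl hr⟩

/-- Permuting colors preserves validity. Outer lists are arbitrary, so they must be pulled back
along `σ`; finiteness makes the injection `σ` surjective. -/
theorem Realizes.map {K : Type*} [Finite K] {t : BinTree} {s : Interface K} (h : Realizes t s)
    {σ : K → K} (hσ : Function.Injective σ) : Realizes t (s.map σ) := by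
  obtain ⟨T, hT, hp, hl, hr, hv⟩ := h
  have key : ∀ {X A : List K}, X.Disjoint (A.map σ) → ∃ X' : List K, X'.Disjoint A ∧ X'.map σ = X := by
    intro X A hX
    obtain ⟨τ, hτ⟩ := (Finite.injective_iff_surjective.1 hσ).hasRightInverse
    have e : (X.map τ).map σ = X := by simp [Function.comp_def, hτ _]
    refine ⟨X.map τ, fun x hx hA => hX (a := σ x) ?_ (List.mem_map_of_mem hA), e⟩
    rw [← e]
    exact List.mem_map_of_mem hx
  refine ⟨T.map σ, (T.shape_map σ).trans hT, ?_, ?_, ?_, fun P L R hP hL hR => ?_⟩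
  · simpa only [Interface.map, Port.map, ColTree.rootColors_map] using List.map_subset σ hp
  · simpa only [Interface.map, Port.map, ColTree.leftColors_map] using List.map_subset σ hl
  · simpa only [Interface.map, Port.map, ColTree.rightColors_map] using List.map_subset σ hr
  · obtain ⟨P', hP', rfl⟩ := key hP
    obtain ⟨L', hL', rfl⟩ := key hL
    obtain ⟨R', hR', rfl⟩ := key hR
    exact (hv P' L' R' hP' hL' hR').map hσ

end HalinColoring

/-! ### The finite certificate for six colors -/

namespace HalinColoring

/-- Binary trees with one leaf, with two leaves, and with more. -/
inductive Kind
  | leaf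
  | cherry
  | big

/-- The kind of a tree, given those of its two subtrees. -/
def Kind.join : Kind → Kind → Kind
  | .leaf, .leaf => .cherry
  | _, _ => .big

def BinTree.kind : BinTree → Kind
  | .leaf => .leaf
  | .node t₁ t₂ => t₁.kind.join t₂.kind

/-- Interfaces that all trees of the given kind realize. -/
def reps : Kind → List (Interface (Fin 6))
  | .leaf => [⟨⟨0, [1, 2], [1, 2]⟩, ⟨1, [0, 2], [2]⟩, ⟨2, [0, 1], []⟩⟩,
      ⟨⟨0, [1, 2], [1, 2]⟩, ⟨1, [0, 2], []⟩, ⟨2, [0, 1], [1]⟩⟩,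
      ⟨⟨0, [1, 2], [1]⟩, ⟨1, [0, 2], [2]⟩, ⟨2, [0, 1], [0]⟩⟩,
      ⟨⟨0, [1, 2], [1]⟩, ⟨1, [0, 2], []⟩, ⟨2, [0, 1], [0, 1]⟩⟩,
      ⟨⟨0, [1, 2], [2]⟩, ⟨1, [0, 2], [0, 2]⟩, ⟨2, [0, 1], []⟩⟩,
      ⟨⟨0, [1, 2], [2]⟩, ⟨1, [0, 2], [0]⟩, ⟨2, [0, 1], [1]⟩⟩]
  | .cherry => [⟨⟨0, [1, 2], []⟩, ⟨1, [2, 3], [2, 3]⟩, ⟨4, [1, 3], []⟩⟩,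
      ⟨⟨0, [1, 2], []⟩, ⟨3, [1, 4], []⟩, ⟨1, [2, 4], [2, 4]⟩⟩,
      ⟨⟨0, [1, 2], []⟩, ⟨3, [1, 4], []⟩, ⟨5, [2, 4], []⟩⟩,
      ⟨⟨0, [1, 2], []⟩, ⟨3, [1, 4], [4]⟩, ⟨3, [2, 4], [4]⟩⟩,
      ⟨⟨0, [1, 2], [1]⟩, ⟨0, [1, 3], [1]⟩, ⟨1, [2, 3], [2, 3]⟩⟩,
      ⟨⟨0, [1, 2], [1]⟩, ⟨0, [1, 3], [1]⟩, ⟨4, [2, 3], []⟩⟩,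
      ⟨⟨0, [1, 2], [1]⟩, ⟨1, [2, 3], [2, 3]⟩, ⟨0, [1, 3], [1]⟩⟩,
      ⟨⟨0, [1, 2], [1]⟩, ⟨3, [2, 4], []⟩, ⟨0, [1, 4], [1]⟩⟩,
      ⟨⟨0, [1, 2], [1, 2]⟩, ⟨3, [0, 1], []⟩, ⟨4, [0, 2], []⟩⟩,
      ⟨⟨0, [1, 2], [1, 2]⟩, ⟨3, [0, 1], [0]⟩, ⟨3, [0, 2], [0]⟩⟩]
  | .big => [⟨⟨0, [1, 2], []⟩, ⟨3, [1, 4], [1, 4]⟩, ⟨2, [1, 5], [1, 5]⟩⟩,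
      ⟨⟨0, [1, 2], [1]⟩, ⟨1, [2, 3], [2, 3]⟩, ⟨4, [2, 5], [2, 5]⟩⟩,
      ⟨⟨0, [1, 2], [1]⟩, ⟨2, [1, 3], [1, 3]⟩, ⟨0, [1, 4], [1, 4]⟩⟩,
      ⟨⟨0, [1, 2], [1]⟩, ⟨3, [2, 4], []⟩, ⟨1, [2, 5], [2, 5]⟩⟩,
      ⟨⟨0, [1, 2], [1]⟩, ⟨3, [2, 4], []⟩, ⟨3, [2, 5], [2, 5]⟩⟩,
      ⟨⟨0, [1, 2], [1]⟩, ⟨3, [2, 4], [4]⟩, ⟨5, [2, 3], [2, 3]⟩⟩,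
      ⟨⟨0, [1, 2], [1, 2]⟩, ⟨0, [1, 3], [1, 3]⟩, ⟨4, [0, 1], [0, 1]⟩⟩,
      ⟨⟨0, [1, 2], [1, 2]⟩, ⟨3, [0, 1], []⟩, ⟨3, [1, 4], [1, 4]⟩⟩,
      ⟨⟨0, [1, 2], [1, 2]⟩, ⟨3, [1, 4], [1, 4]⟩, ⟨3, [0, 1], [0, 1]⟩⟩]

/-- Ways to obtain the interfaces `reps` of a tree from those of its two subtrees: an entry
`(i, σ, j, τ)` refers to the interfaces with the indices `i` and `j`, recolored by `σ` and `τ`. -/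
def joins : Kind → Kind → List (ℕ × (Fin 6 → Fin 6) × ℕ × (Fin 6 → Fin 6))
  | .leaf, .leaf => [(4, ![2, 1, 3, 0, 4, 5], 0, ![1, 3, 4, 0, 2, 5]),
      (1, ![1, 3, 4, 0, 2, 5], 3, ![2, 4, 1, 0, 3, 5]),
      (1, ![1, 3, 4, 0, 2, 5], 0, ![2, 4, 5, 0, 1, 3]),
      (0, ![1, 3, 4, 0, 2, 5], 1, ![2, 4, 3, 0, 1, 5]),
      (5, ![1, 0, 3, 2, 4, 5], 3, ![2, 3, 1, 0, 4, 5]),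
      (5, ![1, 0, 3, 2, 4, 5], 0, ![2, 3, 4, 0, 1, 5]),
      (4, ![2, 1, 3, 0, 4, 5], 2, ![1, 3, 0, 2, 4, 5]),
      (1, ![2, 3, 4, 0, 1, 5], 2, ![1, 4, 0, 2, 3, 5]),
      (3, ![1, 3, 0, 2, 4, 5], 4, ![2, 0, 4, 1, 3, 5]),
      (2, ![1, 3, 0, 2, 4, 5], 5, ![2, 0, 3, 1, 4, 5])]
  | .leaf, .cherry => [(0, ![1, 3, 4, 0, 2, 5], 7, ![2, 5, 3, 4, 1, 0]),
      (4, ![2, 1, 3, 0, 4, 5], 1, ![1, 4, 5, 3, 2, 0]),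
      (4, ![1, 2, 3, 0, 4, 5], 2, ![2, 5, 4, 3, 1, 0]),
      (1, ![2, 3, 4, 0, 1, 5], 7, ![1, 5, 0, 4, 2, 3]),
      (1, ![2, 3, 4, 0, 1, 5], 2, ![1, 0, 2, 4, 5, 3]),
      (0, ![2, 3, 4, 0, 1, 5], 1, ![1, 5, 2, 4, 3, 0]),
      (4, ![1, 0, 3, 2, 4, 5], 1, ![2, 4, 0, 3, 1, 5]),
      (3, ![1, 3, 0, 2, 4, 5], 2, ![2, 5, 1, 0, 4, 3]),
      (0, ![1, 3, 4, 0, 2, 5], 1, ![2, 3, 0, 4, 1, 5])]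
  | .leaf, .big => [(0, ![1, 3, 4, 0, 2, 5], 2, ![2, 5, 4, 0, 1, 3]),
      (4, ![2, 1, 3, 0, 4, 5], 0, ![1, 5, 4, 3, 0, 2]),
      (4, ![1, 2, 3, 0, 4, 5], 1, ![2, 3, 4, 5, 0, 1]),
      (1, ![2, 3, 4, 0, 1, 5], 2, ![1, 5, 4, 0, 2, 3]),
      (1, ![2, 3, 4, 0, 1, 5], 0, ![1, 5, 3, 4, 0, 2]),
      (0, ![2, 3, 4, 0, 1, 5], 3, ![1, 5, 2, 4, 0, 3]),
      (4, ![1, 0, 3, 2, 4, 5], 3, ![2, 4, 0, 3, 5, 1]),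
      (3, ![1, 3, 0, 2, 4, 5], 0, ![2, 4, 3, 0, 5, 1]),
      (0, ![1, 3, 4, 0, 2, 5], 0, ![2, 0, 3, 4, 5, 1])]
  | .cherry, .leaf => [(0, ![2, 3, 4, 1, 5, 0], 2, ![1, 5, 2, 0, 3, 4]),
      (5, ![1, 3, 0, 2, 5, 4], 0, ![2, 5, 4, 0, 1, 3]),
      (5, ![2, 3, 5, 1, 4, 0], 2, ![1, 4, 0, 2, 3, 5]),
      (2, ![1, 4, 0, 3, 2, 5], 2, ![2, 5, 1, 0, 3, 4]),
      (2, ![1, 2, 0, 3, 4, 5], 0, ![2, 5, 3, 0, 1, 4]),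
      (3, ![1, 2, 0, 3, 4, 5], 0, ![2, 3, 5, 0, 1, 4]),
      (3, ![2, 1, 5, 0, 3, 4], 4, ![1, 0, 4, 2, 3, 5]),
      (2, ![2, 0, 5, 3, 1, 4], 0, ![1, 4, 3, 0, 2, 5]),
      (0, ![2, 3, 1, 4, 0, 5], 5, ![1, 0, 3, 2, 4, 5])]
  | .cherry, .cherry => [(0, ![2, 3, 1, 4, 0, 5], 8, ![1, 3, 5, 0, 2, 4]),
      (5, ![1, 3, 4, 2, 0, 5], 8, ![2, 3, 5, 0, 4, 1]),
      (5, ![2, 3, 4, 1, 5, 0], 8, ![1, 3, 4, 5, 0, 2]),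
      (2, ![1, 2, 5, 3, 4, 0], 8, ![2, 3, 5, 0, 1, 4]),
      (2, ![1, 2, 5, 3, 4, 0], 8, ![2, 4, 5, 0, 3, 1]),
      (2, ![1, 2, 5, 3, 4, 0], 8, ![2, 4, 3, 0, 5, 1]),
      (8, ![1, 3, 4, 0, 5, 2], 1, ![2, 4, 0, 5, 1, 3]),
      (7, ![2, 4, 0, 3, 1, 5], 8, ![1, 5, 4, 2, 3, 0]),
      (8, ![1, 4, 5, 3, 2, 0], 4, ![2, 3, 0, 1, 4, 5])]
  | .cherry, .big => [(6, ![2, 3, 1, 4, 0, 5], 8, ![1, 5, 3, 2, 0, 4]),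
      (5, ![1, 3, 0, 2, 4, 5], 8, ![2, 5, 3, 4, 1, 0]),
      (5, ![2, 3, 5, 1, 0, 4], 8, ![1, 4, 3, 0, 2, 5]),
      (1, ![1, 2, 0, 3, 4, 5], 6, ![2, 5, 4, 3, 1, 0]),
      (1, ![1, 2, 0, 3, 4, 5], 6, ![2, 5, 4, 1, 3, 0]),
      (1, ![1, 2, 0, 3, 4, 5], 6, ![2, 3, 4, 1, 5, 0]),
      (8, ![1, 3, 4, 0, 5, 2], 0, ![2, 0, 4, 5, 3, 1]),
      (1, ![2, 1, 5, 3, 0, 4], 6, ![1, 4, 5, 2, 3, 0]),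
      (8, ![1, 4, 5, 3, 0, 2], 5, ![2, 5, 1, 0, 4, 3])]
  | .big, .leaf => [(0, ![2, 4, 5, 3, 1, 0], 2, ![1, 5, 2, 0, 3, 4]),
      (6, ![1, 3, 4, 2, 5, 0], 0, ![2, 5, 4, 0, 1, 3]),
      (6, ![2, 3, 5, 1, 4, 0], 2, ![1, 4, 0, 2, 3, 5]),
      (3, ![1, 5, 4, 3, 2, 0], 2, ![2, 5, 1, 0, 3, 4]),
      (3, ![1, 5, 4, 3, 2, 0], 0, ![2, 5, 3, 0, 1, 4]),
      (4, ![1, 5, 4, 3, 2, 0], 0, ![2, 3, 5, 0, 1, 4]),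
      (4, ![2, 4, 3, 0, 1, 5], 4, ![1, 0, 4, 2, 3, 5]),
      (3, ![2, 4, 0, 3, 1, 5], 0, ![1, 4, 3, 0, 2, 5]),
      (0, ![2, 4, 0, 3, 1, 5], 4, ![1, 0, 3, 2, 4, 5])]
  | .big, .cherry => [(1, ![2, 3, 4, 1, 0, 5], 8, ![1, 3, 5, 0, 2, 4]),
      (7, ![2, 3, 4, 1, 0, 5], 4, ![1, 4, 2, 5, 0, 3]),
      (6, ![2, 3, 4, 1, 0, 5], 9, ![1, 5, 4, 0, 2, 3]),
      (7, ![2, 4, 5, 3, 1, 0], 7, ![1, 5, 0, 3, 2, 4]),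
      (7, ![2, 4, 5, 3, 1, 0], 3, ![1, 0, 2, 3, 5, 4]),
      (7, ![2, 4, 5, 3, 1, 0], 0, ![1, 3, 0, 2, 5, 4]),
      (7, ![1, 3, 4, 0, 2, 5], 0, ![2, 0, 5, 1, 4, 3]),
      (4, ![2, 5, 0, 3, 1, 4], 9, ![1, 5, 4, 3, 0, 2]),
      (7, ![1, 4, 5, 3, 0, 2], 3, ![2, 5, 0, 3, 1, 4])]
  | .big, .big => [(2, ![2, 4, 3, 1, 0, 5], 8, ![1, 5, 4, 2, 3, 0]),
      (6, ![1, 3, 5, 2, 4, 0], 8, ![2, 5, 3, 4, 0, 1]),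
      (6, ![2, 3, 4, 1, 0, 5], 8, ![1, 4, 3, 0, 5, 2]),
      (7, ![2, 4, 5, 3, 1, 0], 2, ![1, 5, 3, 0, 2, 4]),
      (4, ![1, 5, 2, 3, 4, 0], 8, ![2, 5, 4, 3, 1, 0]),
      (3, ![1, 5, 2, 3, 4, 0], 8, ![2, 3, 4, 5, 1, 0]),
      (7, ![1, 3, 4, 0, 2, 5], 5, ![2, 3, 1, 0, 5, 4]),
      (4, ![2, 4, 0, 3, 1, 5], 8, ![1, 4, 5, 3, 2, 0]),
      (7, ![1, 4, 5, 3, 0, 2], 4, ![2, 4, 1, 3, 5, 0])]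

instance {K : Type*} [DecidableEq K] (l₁ l₂ : List K) : Decidable (l₁.Disjoint l₂) :=
  inferInstanceAs (Decidable (∀ a ∈ l₁, a ∉ l₂))

instance {K : Type*} [DecidableEq K] (s : Interface K) : Decidable (LeafOK s) := by
  unfold LeafOK; infer_instance

instance {K : Type*} [DecidableEq K] (s : Interface K) : Decidable (Closes s) := by
  unfold Closes; infer_instance

instance {K : Type*} [DecidableEq K] (s₁ s₂ s : Interface K) : Decidable (Glue s₁ s₂ s) := by
  unfold Glue; infer_instance

theorem leafOK_of_mem_reps : ∀ s ∈ reps .leaf, LeafOK s := by decide +kernel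

/-- The inductive step as a finite check. The table `joins` supplies witnesses, so no search over
color permutations is needed. -/
theorem exists_glue (k₁ k₂ : Kind) : ∀ s ∈ reps (k₁.join k₂), ∃ x ∈ joins k₁ k₂,
    x.2.1.Injective ∧ x.2.2.2.Injective ∧ ∃ s₁ ∈ (reps k₁)[x.1]?, ∃ s₂ ∈ (reps k₂)[x.2.2.1]?,
      Glue (s₁.map x.2.1) (s₂.map x.2.2.2) s := by
  cases k₁ <;> cases k₂ <;> decide +kernel

/-- Only cherries and larger trees occur here: with at least four vertices, the tree beyond the root
leaf is not a single leaf. -/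
theorem exists_closes (k₁ k₂ : Kind) : ∃ s ∈ reps (k₁.join k₂), Closes s := by
  cases k₁ <;> cases k₂ <;> decide +kernel

theorem realizes_of_mem_reps (t : BinTree) : ∀ s ∈ reps t.kind, Realizes t s := by
  induction t with
  | leaf => exact fun s hs => realizes_leaf (leafOK_of_mem_reps s hs)
  | node t₁ t₂ ih₁ ih₂ =>
    intro s hs
    obtain ⟨x, -, h₁, h₂, s₁, hs₁, s₂, hs₂, h⟩ := exists_glue _ _ s hs
    exact realizes_node ((ih₁ s₁ (List.mem_of_getElem? hs₁)).map h₁)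
      ((ih₂ s₂ (List.mem_of_getElem? hs₂)).map h₂) h

/-- Every binary tree with at least two leaves has a valid coloring with six colors when its three
outer edges are joined in one further vertex. -/
theorem exists_valid (t₁ t₂ : BinTree) : ∃ (T : ColTree (Fin 6)) (p l r : Fin 6),
    T.shape = .node t₁ t₂ ∧ T.Valid [l, r] [p, r] [p, l] p l r ∧
    VertexOK p l r (T.rootColors l r) (T.leftColors p r) (T.rightColors p l) := by
  obtain ⟨s, hs, h⟩ := exists_closes t₁.kind t₂.kind
  exact (realizes_of_mem_reps (.node t₁ t₂) s hs).closes h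

end HalinColoring

/-! ### Plane cubic trees and the order of their leaves -/

namespace SimpleGraph

namespace Dart

variable {V : Type*} {T : SimpleGraph V}

theorem ext_of_fst_snd {d e : T.Dart} (h₁ : d.fst = e.fst) (h₂ : d.snd = e.snd) : d = e :=
  Dart.ext _ _ (Prod.ext h₁ h₂)

/-- The vertices beyond the dart `d`: those reached by a path that starts with `d`. -/
def beyond (d : T.Dart) : Set V :=
  {v | ∃ p : T.Walk d.snd v, p.IsPath ∧ d.fst ∉ p.support}

theorem snd_mem_beyond (d : T.Dart) : d.snd ∈ d.beyond :=
  ⟨.nil, .nil, by simp⟩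

theorem fst_notMem_beyond (d : T.Dart) : d.fst ∉ d.beyond :=
  fun ⟨p, _, hp⟩ => hp p.end_mem_support

theorem beyond_eq_singleton {d : T.Dart} (h : T.IsLeaf d.snd) : d.beyond = {d.snd} := by
  obtain ⟨w, hw⟩ := Set.ncard_eq_one.1 h
  refine Set.eq_singleton_iff_unique_mem.2 ⟨d.snd_mem_beyond, ?_⟩
  rintro v ⟨p, -, hp⟩
  cases p with
  | nil => rfl
  | @cons _ u _ hu q =>
    have h1 : u ∈ T.neighborSet d.snd := hu
    have h2 : d.fst ∈ T.neighborSet d.snd := d.adj.symm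
    rw [hw, Set.mem_singleton_iff] at h1 h2
    obtain rfl : u = d.fst := h1.trans h2.symm
    exact absurd (by simp) hp

/-- Prepending `e` to a path beyond `e` gives a path from `d.snd`. In an acyclic graph it could
contain the neighbor `d.fst` only as its second vertex, which would force `e = d.symm`. -/
theorem beyond_subset_beyond (hT : T.IsAcyclic) {d e : T.Dart} (h : e.fst = d.snd)
    (hne : e ≠ d.symm) : e.beyond ⊆ d.beyond := by
  classical
  rintro v ⟨p, hp, hpe⟩
  obtain ⟨⟨x, y⟩, hxy⟩ := e
  obtain rfl : x = d.snd := h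
  refine ⟨.cons hxy p, hp.cons hpe, fun hmem => hne ?_⟩
  have := hT.eq_snd_of_adj_start (hp.cons (h := hxy) hpe) d.adj.symm hmem
  exact ext_of_fst_snd rfl (by simpa using this.symm)

/-- A common vertex would have two paths from `d.fst` with different first edges. -/
theorem disjoint_beyond (hT : T.IsAcyclic) {d e : T.Dart} (h : d.fst = e.fst) (hne : d ≠ e) :
    Disjoint d.beyond e.beyond := by
  rw [Set.disjoint_left]
  rintro v ⟨p, hp, hpd⟩ ⟨q, hq, hqe⟩
  obtain ⟨⟨x, y⟩, hxy⟩ := d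
  obtain ⟨⟨x', z⟩, hxz⟩ := e
  obtain rfl : x = x' := h
  have := hT.subsingleton_path x v |>.elim ⟨_, hp.cons (h := hxy) hpd⟩ ⟨_, hq.cons (h := hxz) hqe⟩
  have := congrArg Walk.snd (congrArg Subtype.val this)
  exact hne (ext_of_fst_snd rfl (by simpa using this))

end Dart

namespace RotationSystem

variable {V : Type*} {T : SimpleGraph V} (R : RotationSystem T)

/-- The dart to the left child of the head of `d`. -/
def left (d : T.Dart) : T.Dart := R.rot d.symm

/-- The dart to the right child of the head of `d`. -/
def right (d : T.Dart) : T.Dart := R.rot (R.rot d.symm)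

@[simp] theorem fst_left (d : T.Dart) : (R.left d).fst = d.snd := R.fst_rot _

@[simp] theorem fst_right (d : T.Dart) : (R.right d).fst = d.snd :=
  (R.fst_rot _).trans (R.fst_rot _)

/-- Every vertex that is not a leaf has exactly three neighbors. -/
def _root_.SimpleGraph.IsCubicTree (T : SimpleGraph V) : Prop :=
  T.IsTree ∧ ∀ v, ¬ T.IsLeaf v → (T.neighborSet v).ncard = 3

theorem isCycleOn (v : V) : R.rot.IsCycleOn {e | e.fst = v} := by
  refine ⟨⟨fun e he => (R.fst_rot e).trans he, R.rot.injective.injOn, fun e he => ?_⟩,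
    fun d hd e he => R.sameCycle d e (Eq.trans hd (Eq.symm he))⟩
  refine ⟨R.rot.symm e, ?_, by simp⟩
  have := R.fst_rot (R.rot.symm e)
  rw [Equiv.apply_symm_apply] at this
  exact this.symm.trans he

theorem ncard_darts (v : V) : {e : T.Dart | e.fst = v}.ncard = (T.neighborSet v).ncard := by
  symm
  refine Set.ncard_congr (fun w hw => ⟨(v, w), hw⟩) (fun _ _ => rfl) ?_ ?_
  · intro a b _ _ h
    exact congrArg (fun e : T.Dart => e.snd) h
  · rintro e rfl
    exact ⟨e.snd, e.adj, rfl⟩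

variable {R}

/-- The rotation at a vertex of degree three is a 3-cycle, `d.symm` to left child to right child and
back, so a power of it fixes a dart only if the exponent is divisible by 3. -/
theorem rot_facts [Finite V] (hT : T.IsCubicTree) {d : T.Dart} (hd : ¬ T.IsLeaf d.snd) :
    R.left d ≠ d.symm ∧ R.right d ≠ d.symm ∧ R.left d ≠ R.right d ∧ R.rot (R.right d) = d.symm ∧
      ∀ e : T.Dart, e.fst = d.snd → e = d.symm ∨ e = R.left d ∨ e = R.right d := by
  have hcard := (ncard_darts (T := T) d.snd).trans (hT.2 _ hd)
  have hfin : {e : T.Dart | e.fst = d.snd}.Finite := Set.finite_of_ncard_ne_zero (by omega)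
  have hc := R.isCycleOn d.snd
  obtain ⟨s, hs⟩ := hfin.exists_finset_coe
  rw [← hs] at hc
  rw [← hs, Set.ncard_coe_finset] at hcard
  have hm : d.symm ∈ s := by rw [← Finset.mem_coe, hs]; rfl
  have h1 := hc.pow_apply_eq hm (n := 1)
  have h2 := hc.pow_apply_eq hm (n := 2)
  have h3 := hc.pow_apply_eq hm (n := 3)
  rw [hcard] at h1 h2 h3
  refine ⟨fun h => ?_, fun h => ?_, fun h => ?_, ?_, fun e he => ?_⟩
  · have := h1.1 (by simpa [left] using h); omega
  · have := h2.1 (by simpa [pow_two, right] using h); omega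
  · have h' : R.rot d.symm = R.rot (R.rot d.symm) := h
    have := h1.1 (by simpa using (R.rot.injective h').symm); omega
  · simpa [pow_succ, right] using h3.2 dvd_rfl
  · have he' : e ∈ s := by rw [← Finset.mem_coe, hs]; exact he
    obtain ⟨n, hn, rfl⟩ := hc.exists_pow_eq hm he'
    rw [hcard] at hn
    interval_cases n
    · exact .inl rfl
    · exact .inr (.inl rfl)
    · exact .inr (.inr rfl)

theorem beyond_eq [Finite V] (hT : T.IsCubicTree) {d : T.Dart} (hd : ¬ T.IsLeaf d.snd) :
    d.beyond = insert d.snd ((R.left d).beyond ∪ (R.right d).beyond) := by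
  obtain ⟨h1, h2, -, -, h5⟩ := rot_facts (R := R) hT hd
  refine Set.Subset.antisymm ?_ (Set.insert_subset d.snd_mem_beyond (Set.union_subset
    (Dart.beyond_subset_beyond hT.1.isAcyclic (by simp) h1)
    (Dart.beyond_subset_beyond hT.1.isAcyclic (by simp) h2)))
  rintro v ⟨p, hp, hpd⟩
  cases p with
  | nil => exact Set.mem_insert _ _
  | @cons _ u _ hu q =>
    rw [Walk.cons_isPath_iff] at hp
    rw [Walk.support_cons, List.mem_cons, not_or] at hpd
    have hmem : v ∈ (⟨(d.snd, u), hu⟩ : T.Dart).beyond := ⟨q, hp.1, hp.2⟩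
    rcases h5 ⟨(d.snd, u), hu⟩ rfl with h | h | h
    · have : u = d.fst := congrArg (fun e : T.Dart => e.snd) h
      exact absurd (this ▸ q.start_mem_support) hpd.2
    · exact .inr (.inl (h ▸ hmem))
    · exact .inr (.inr (h ▸ hmem))

theorem snd_notMem_beyond_left (d : T.Dart) : d.snd ∉ (R.left d).beyond := by
  have := (R.left d).fst_notMem_beyond
  rwa [fst_left] at this

theorem snd_notMem_beyond_right (d : T.Dart) : d.snd ∉ (R.right d).beyond := by
  have := (R.right d).fst_notMem_beyond
  rwa [fst_right] at this

theorem disjoint_beyond [Finite V] (hT : T.IsCubicTree) {d : T.Dart} (hd : ¬ T.IsLeaf d.snd) :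
    Disjoint (R.left d).beyond (R.right d).beyond :=
  Dart.disjoint_beyond hT.1.isAcyclic (by simp) (rot_facts hT hd).2.2.1

variable (R)

open HalinColoring (BinTree ColTree)

/-- The part of the plane tree beyond the dart `d` is the binary tree `t`. -/
def Spans : BinTree → T.Dart → Prop
  | .leaf, d => T.IsLeaf d.snd
  | .node t₁ t₂, d => ¬ T.IsLeaf d.snd ∧ Spans t₁ (R.left d) ∧ Spans t₂ (R.right d)

/-- The dart that enters the first leaf of the binary tree `t` beyond `d`. -/
def firstLeaf : BinTree → T.Dart → T.Dart
  | .leaf, d => d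
  | .node t₁ _, d => firstLeaf t₁ (R.left d)

/-- The dart that enters the last leaf of the binary tree `t` beyond `d`. -/
def lastLeaf : BinTree → T.Dart → T.Dart
  | .leaf, d => d
  | .node _ t₂, d => lastLeaf t₂ (R.right d)

/-- Induction on the number of vertices beyond `d`: the parts beyond both children omit `d.snd`. -/
theorem exists_spans [Finite V] (hT : T.IsCubicTree) (d : T.Dart) : ∃ t, R.Spans t d := by
  induction h : d.beyond.ncard using Nat.strong_induction_on generalizing d with
  | _ n ih =>
    subst h
    by_cases hd : T.IsLeaf d.snd
    · exact ⟨.leaf, hd⟩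
    · have e := beyond_eq (R := R) hT hd
      obtain ⟨t₁, h₁⟩ := ih _ (Set.ncard_lt_ncard (Set.ssubset_iff_exists.2
        ⟨Set.subset_union_left.trans ((Set.subset_insert _ _).trans e.symm.subset),
          d.snd, d.snd_mem_beyond, snd_notMem_beyond_left (R := R) d⟩)) (R.left d) rfl
      obtain ⟨t₂, h₂⟩ := ih _ (Set.ncard_lt_ncard (Set.ssubset_iff_exists.2
        ⟨Set.subset_union_right.trans ((Set.subset_insert _ _).trans e.symm.subset),
          d.snd, d.snd_mem_beyond, snd_notMem_beyond_right (R := R) d⟩)) (R.right d) rfl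
      exact ⟨.node t₁ t₂, hd, h₁, h₂⟩

variable {R}

theorem Spans.isLeaf_firstLeaf {t : BinTree} {d : T.Dart} (h : R.Spans t d) :
    T.IsLeaf (R.firstLeaf t d).snd := by
  induction t generalizing d with
  | leaf => exact h
  | node t₁ t₂ ih₁ ih₂ => exact ih₁ h.2.1

theorem Spans.isLeaf_lastLeaf {t : BinTree} {d : T.Dart} (h : R.Spans t d) :
    T.IsLeaf (R.lastLeaf t d).snd := by
  induction t generalizing d with
  | leaf => exact h
  | node t₁ t₂ ih₁ ih₂ => exact ih₂ h.2.2

variable (R)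

/-- The boundary walk leads from `d` to `e`, with no leaf on the way before the head of `e`. -/
def Run (d e : T.Dart) : Prop :=
  ∃ n : ℕ, R.faceStep^[n] d = e ∧ ∀ i < n, ¬ T.IsLeaf (R.faceStep^[i] d).snd

variable {R}

theorem Run.refl (d : T.Dart) : R.Run d d := ⟨0, rfl, by simp⟩

theorem Run.head {d e : T.Dart} (hd : ¬ T.IsLeaf d.snd) (h : R.Run (R.faceStep d) e) :
    R.Run d e := by
  obtain ⟨n, rfl, hn⟩ := h
  refine ⟨n + 1, rfl, fun i hi => ?_⟩
  cases i with
  | zero => exact hd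
  | succ i => exact hn i (by omega)

theorem Run.trans {d e f : T.Dart} (h₁ : R.Run d e) (h₂ : R.Run e f) : R.Run d f := by
  obtain ⟨n, hn, h⟩ := h₁
  induction n generalizing d with
  | zero => exact (show d = e from hn) ▸ h₂
  | succ n ih => exact .head (h 0 (by omega)) (ih hn fun i hi => h (i + 1) (by omega))

theorem Spans.run_firstLeaf {t : BinTree} {d : T.Dart} (h : R.Spans t d) :
    R.Run d (R.firstLeaf t d) := by
  induction t generalizing d with
  | leaf => exact .refl d
  | node t₁ t₂ ih₁ ih₂ => exact .head h.1 (ih₁ h.2.1)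

/-- On return from a right child, the rotation leads on to the parent. -/
theorem Spans.run_lastLeaf [Finite V] (hT : T.IsCubicTree) {t : BinTree} {d : T.Dart}
    (h : R.Spans t d) : R.Run (R.lastLeaf t d).symm d.symm := by
  induction t generalizing d with
  | leaf => exact .refl _
  | node t₁ t₂ ih₁ ih₂ =>
    refine (ih₂ h.2.2).trans (.head ?_ ?_)
    · have : (R.right d).symm.snd = d.snd := fst_right R d
      rw [this]; exact h.1
    · rw [faceStep, Dart.symm_symm, (rot_facts hT h.1).2.2.2.1]
      exact .refl _

theorem Run.isNextLeaf {d e : T.Dart} (h : R.Run d e) (hd : T.IsLeaf d.fst) (he : T.IsLeaf e.snd) :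
    R.IsNextLeaf d.fst e.snd := by
  obtain ⟨n, rfl, hn⟩ := h
  exact ⟨hd, he, d, n, rfl, rfl, hn⟩

/-- The walk climbs from the last leaf on the left to `d.snd`, turns into the right child, and
descends to the first leaf there. -/
theorem Spans.isNextLeaf [Finite V] (hT : T.IsCubicTree) {t₁ t₂ : BinTree} {d : T.Dart}
    (h : R.Spans (.node t₁ t₂) d) :
    R.IsNextLeaf (R.lastLeaf t₁ (R.left d)).snd (R.firstLeaf t₂ (R.right d)).snd := by
  have hr : R.Run (R.left d).symm (R.firstLeaf t₂ (R.right d)) := by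
    refine .head ?_ ?_
    · have : (R.left d).symm.snd = d.snd := fst_left R d
      rw [this]; exact h.1
    · rw [faceStep, Dart.symm_symm]
      exact h.2.2.run_firstLeaf
  exact ((h.2.1.run_lastLeaf hT).trans hr).isNextLeaf h.2.1.isLeaf_lastLeaf
    h.2.2.isLeaf_firstLeaf

theorem _root_.SimpleGraph.IsLeaf.dart_unique {d e : T.Dart} (hd : T.IsLeaf d.fst)
    (h : d.fst = e.fst) : d = e := by
  obtain ⟨w, hw⟩ := Set.ncard_eq_one.1 hd
  have h1 : d.snd ∈ T.neighborSet d.fst := d.adj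
  have h2 : e.snd ∈ T.neighborSet d.fst := h ▸ e.adj
  rw [hw, Set.mem_singleton_iff] at h1 h2
  exact Dart.ext_of_fst_snd h (h1.trans h2.symm)

/-- A leaf has one outgoing dart, and the deterministic walk stops at the first leaf it meets. -/
theorem IsNextLeaf.right_unique {x y y' : V} (h : R.IsNextLeaf x y) (h' : R.IsNextLeaf x y') :
    y = y' := by
  obtain ⟨hx, hy, d, n, rfl, rfl, hn⟩ := h
  obtain ⟨-, hy', d', n', hd', rfl, hn'⟩ := h'
  obtain rfl := hx.dart_unique hd'.symm
  rcases lt_trichotomy n n' with h | rfl | h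
  · exact absurd hy (hn' n h)
  · rfl
  · exact absurd hy' (hn n' h)

theorem faceStep_injective : Function.Injective R.faceStep := fun _ _ h =>
  Dart.symm_involutive.injective (R.rot.injective h)

theorem snd_of_faceStep_eq {d e : T.Dart} (h : R.faceStep d = e) : d.snd = e.fst := by
  rw [← h]; exact (R.fst_rot d.symm).symm

/-- Both walks enter the leaf `y` by its only edge, so they can be traced back by injectivity of
`faceStep`. -/
theorem IsNextLeaf.left_unique {x x' y : V} (h : R.IsNextLeaf x y) (h' : R.IsNextLeaf x' y) :
    x = x' := by
  obtain ⟨hx, hy, d, n, rfl, hdy, hn⟩ := h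
  obtain ⟨hx', -, d', n', rfl, hdy', hn'⟩ := h'
  have key : ∀ {d d' : T.Dart} {n n' : ℕ}, T.IsLeaf d.fst → n < n' →
      (∀ i < n', ¬ T.IsLeaf (R.faceStep^[i] d').snd) →
      R.faceStep^[n] d ≠ R.faceStep^[n'] d' := by
    intro d d' n n' hd hlt hn' he
    -- After cancelling `n` steps, the longer walk passes through `d` at time `k + 1`; at time `k`
    -- its head is then the leaf `d.fst`, too early.
    obtain ⟨k, rfl⟩ : ∃ k, n' = n + (k + 1) := ⟨n' - n - 1, by omega⟩
    rw [Function.iterate_add_apply] at he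
    have he := faceStep_injective.iterate n he
    rw [Function.iterate_succ_apply'] at he
    exact hn' k (by omega) (snd_of_faceStep_eq he.symm ▸ hd)
  have he : R.faceStep^[n] d = R.faceStep^[n'] d' := by
    refine Dart.symm_involutive.injective (IsLeaf.dart_unique ?_ ?_)
    · exact (show (R.faceStep^[n] d).symm.fst = y from hdy) ▸ hy
    · exact hdy.trans hdy'.symm
  rcases lt_trichotomy n n' with h | rfl | h
  · exact absurd he (key hx h hn')
  · rw [faceStep_injective.iterate n he]
  · exact absurd he.symm (key hx' h hn)

end RotationSystem

end SimpleGraph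

/-! ### Star colorings from lists of neighbors -/

namespace SimpleGraph

open HalinColoring

/-- Here and below, `g` lists for each vertex three others, its neighbors, with the colors of the
edges to them. The color `c` occurs at `w` on an edge that does not lead to `v`. -/
def FarColor {V K : Type*} (g : V → Fin 3 → V × K) (w v : V) (c : K) : Prop :=
  ∃ k, (g w k).1 ≠ v ∧ (g w k).2 = c

/-- The conditions at `v` for a star coloring: `v` is not the middle vertex of a two-colored path or
cycle with four edges. -/
def StarAt {V K : Type*} (g : V → Fin 3 → V × K) (v : V) : Prop :=
  (∀ i k, i ≠ k → (g v i).2 ≠ (g v k).2) ∧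
  ∀ i k, i ≠ k → ¬ (FarColor g (g v i).1 v (g v k).2 ∧ FarColor g (g v k).1 v (g v i).2)

theorem starAt_of_vertexOK {V K : Type*} {g : V → Fin 3 → V × K} {v x y z : V} {a b c : K}
    {A B C : List K} (hg : g v = ![(x, a), (y, b), (z, c)]) (h : VertexOK a b c A B C)
    (hA : ∀ k, FarColor g x v k → k ∈ A) (hB : ∀ k, FarColor g y v k → k ∈ B)
    (hC : ∀ k, FarColor g z v k → k ∈ C) : StarAt g v := by
  obtain ⟨⟨h1, h2, h3⟩, h4, h5, h6⟩ := h
  have k4 : ¬ (FarColor g x v b ∧ FarColor g y v a) := fun e => h4 ⟨hA _ e.1, hB _ e.2⟩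
  have k5 : ¬ (FarColor g x v c ∧ FarColor g z v a) := fun e => h5 ⟨hA _ e.1, hC _ e.2⟩
  have k6 : ¬ (FarColor g y v c ∧ FarColor g z v b) := fun e => h6 ⟨hB _ e.1, hC _ e.2⟩
  have m4 := fun e => k4 (And.symm e)
  have m5 := fun e => k5 (And.symm e)
  have m6 := fun e => k6 (And.symm e)
  constructor <;> intro i k hik <;> rw [hg] <;> fin_cases i <;> fin_cases k <;>
    first
    | exact absurd rfl hik
    | assumption
    | exact Ne.symm (by assumption)

section

variable {V K : Type*} {g : V → Fin 3 → V × K} {w : V} {x y z : V × K} {c : K}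

theorem FarColor.mem_of_fst (hg : g w = ![x, y, z]) (h : FarColor g w x.1 c) :
    c ∈ [y.2, z.2] := by
  obtain ⟨k, hk, rfl⟩ := h
  rw [hg] at hk ⊢
  fin_cases k
  exacts [absurd rfl hk, .head _, .tail _ (.head _)]

theorem FarColor.mem_of_snd (hg : g w = ![x, y, z]) (h : FarColor g w y.1 c) :
    c ∈ [x.2, z.2] := by
  obtain ⟨k, hk, rfl⟩ := h
  rw [hg] at hk ⊢
  fin_cases k
  exacts [.head _, absurd rfl hk, .tail _ (.head _)]

theorem FarColor.mem_of_trd (hg : g w = ![x, y, z]) (h : FarColor g w z.1 c) :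
    c ∈ [x.2, y.2] := by
  obtain ⟨k, hk, rfl⟩ := h
  rw [hg] at hk ⊢
  fin_cases k
  exacts [.head _, .tail _ (.head _), absurd rfl hk]

end

/-- A vertex is listed by each vertex that it lists, with the same color. -/
def SymmAt {V K : Type*} (g : V → Fin 3 → V × K) (v : V) : Prop :=
  ∀ i, ∃ j, g (g v i).1 j = (v, (g v i).2)

/-- An edge takes its color from the list at a chosen end; by `hsymm` and `hinj` the other end gives
the same one. -/
theorem exists_isStar {V K : Type*} {G : SimpleGraph V} (g : V → Fin 3 → V × K)
    (hadj : ∀ v w, G.Adj v w ↔ ∃ i, (g v i).1 = w) (hinj : ∀ v i k, (g v i).1 = (g v k).1 → i = k)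
    (hsymm : ∀ v, SymmAt g v) (hstar : ∀ v, StarAt g v) : ∃ f : G.EdgeLabeling K, f.IsStar := by
  have hex : ∀ e : G.edgeSet, ∃ v i, s(v, (g v i).1) = (e : Sym2 V) := by
    rintro ⟨e, he⟩
    induction e with
    | _ v w =>
      obtain ⟨i, rfl⟩ := (hadj v w).1 he
      exact ⟨v, i, rfl⟩
  choose v i hvi using hex
  let f : G.EdgeLabeling K := fun e => (g (v e) (i e)).2
  have hf : ∀ (e : G.edgeSet) (x : V) (k : Fin 3), (e : Sym2 V) = s(x, (g x k).1) →
      f e = (g x k).2 := by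
    intro e x k he
    have h := (hvi e).trans he
    rcases Sym2.eq_iff.1 h with ⟨h1, h2⟩ | ⟨h1, h2⟩
    · rw [h1] at h2
      change (g (v e) (i e)).2 = _
      rw [h1, hinj _ _ _ h2]
    · obtain ⟨j, hj⟩ := hsymm x k
      rw [← h1] at hj
      have : i e = j := hinj _ _ _ (by rw [h2, hj])
      change (g (v e) (i e)).2 = _
      rw [this, hj]
  have hproper : f.IsProper := by
    rintro e e' hne ⟨x, hx, hx'⟩ heq
    obtain ⟨y, hy⟩ := hx
    obtain ⟨y', hy'⟩ := hx'
    obtain ⟨k, rfl⟩ := (hadj x y).1 (by rw [← mem_edgeSet, ← hy]; exact e.2)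
    obtain ⟨k', rfl⟩ := (hadj x y').1 (by rw [← mem_edgeSet, ← hy']; exact e'.2)
    rw [hf e x k hy, hf e' x k' hy'] at heq
    by_cases hk : k = k'
    · exact hne (Subtype.ext (by rw [hy, hy', hk]))
    · exact (hstar x).1 k k' hk heq
  have key : ∀ v₀ v₁ v₂ v₃ v₄ : V, ∀ (h₁ : G.Adj v₀ v₁) (h₂ : G.Adj v₁ v₂) (h₃ : G.Adj v₂ v₃)
      (h₄ : G.Adj v₃ v₄), v₀ ≠ v₂ → v₁ ≠ v₃ → v₂ ≠ v₄ →
      ∀ a b, (∀ e : G.edgeSet, (e : Sym2 V) ∈ [s(v₀, v₁), s(v₁, v₂), s(v₂, v₃), s(v₃, v₄)] →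
        f e = a ∨ f e = b) → False := by
    intro v₀ v₁ v₂ v₃ v₄ h₁ h₂ h₃ h₄ n₁ n₂ n₃ a b hab
    obtain ⟨k₁, e₁⟩ := (hadj v₂ v₁).1 h₂.symm
    obtain ⟨k₃, e₃⟩ := (hadj v₂ v₃).1 h₃
    obtain ⟨k₀, e₀⟩ := (hadj v₁ v₀).1 h₁.symm
    obtain ⟨k₄, e₄⟩ := (hadj v₃ v₄).1 h₄
    have c₁ := hab ⟨s(v₀, v₁), h₁⟩ (by simp)
    have c₂ := hab ⟨s(v₁, v₂), h₂⟩ (by simp)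
    have c₃ := hab ⟨s(v₂, v₃), h₃⟩ (by simp)
    have c₄ := hab ⟨s(v₃, v₄), h₄⟩ (by simp)
    have d₁ : f ⟨s(v₀, v₁), h₁⟩ = (g v₁ k₀).2 := hf _ _ _ (by rw [e₀]; exact Sym2.eq_swap)
    have d₂ : f ⟨s(v₁, v₂), h₂⟩ = (g v₂ k₁).2 := hf _ _ _ (by rw [e₁]; exact Sym2.eq_swap)
    have d₃ : f ⟨s(v₂, v₃), h₃⟩ = (g v₂ k₃).2 := hf _ _ _ (by rw [e₃])
    have d₄ : f ⟨s(v₃, v₄), h₄⟩ = (g v₃ k₄).2 := hf _ _ _ (by rw [e₄])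
    have p₁ : f ⟨s(v₀, v₁), h₁⟩ ≠ f ⟨s(v₁, v₂), h₂⟩ := hproper _ _ (fun h => n₁ (by
      have := Sym2.eq_iff.1 (congrArg Subtype.val h); grind)) ⟨v₁, by simp, by simp⟩
    have p₂ : f ⟨s(v₁, v₂), h₂⟩ ≠ f ⟨s(v₂, v₃), h₃⟩ := hproper _ _ (fun h => n₂ (by
      have := Sym2.eq_iff.1 (congrArg Subtype.val h); grind)) ⟨v₂, by simp, by simp⟩
    have p₃ : f ⟨s(v₂, v₃), h₃⟩ ≠ f ⟨s(v₃, v₄), h₄⟩ := hproper _ _ (fun h => n₃ (by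
      have := Sym2.eq_iff.1 (congrArg Subtype.val h); grind)) ⟨v₃, by simp, by simp⟩
    -- Two colors on consecutively distinct edges must alternate, which `StarAt` forbids at the
    -- middle vertex `v₂`.
    have q₁ : f ⟨s(v₀, v₁), h₁⟩ = f ⟨s(v₂, v₃), h₃⟩ := by grind
    have q₂ : f ⟨s(v₁, v₂), h₂⟩ = f ⟨s(v₃, v₄), h₄⟩ := by grind
    refine (hstar v₂).2 k₁ k₃ (fun h => n₂ (by rw [← e₁, ← e₃, h])) ⟨?_, ?_⟩
    · rw [e₁, ← d₃, ← q₁, d₁]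
      exact ⟨k₀, by rwa [e₀], rfl⟩
    · rw [e₃, ← d₂, q₂, d₄]
      exact ⟨k₄, by rw [e₄]; exact n₃.symm, rfl⟩
  refine ⟨f, hproper, ?_, ?_⟩
  · rintro u w p hp hlen ⟨a, b, hab⟩
    match p, hp, hlen, hab with
    | .cons h₁ (.cons h₂ (.cons h₃ (.cons h₄ .nil))), hp, _, hab =>
      simp only [Walk.cons_isPath_iff, Walk.support_cons, Walk.support_nil, List.mem_cons] at hp
      exact key _ _ _ _ _ h₁ h₂ h₃ h₄ (by grind) (by grind) (by grind) a b hab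
  · rintro u p hp hlen ⟨a, b, hab⟩
    match p, hp, hlen, hab with
    | .cons h₁ (.cons h₂ (.cons h₃ (.cons h₄ .nil))), hp, _, hab =>
      have hp := hp.support_nodup
      simp only [Walk.support_cons, Walk.support_nil, List.tail_cons, List.nodup_cons,
        List.mem_cons] at hp
      exact key _ _ _ _ _ h₁ h₂ h₃ h₄ (by grind) (by grind) (by grind) a b hab

/-! ### Transfer of a colored binary tree to the plane tree -/

namespace RotationSystem

variable {V K : Type*} {T : SimpleGraph V} (R : RotationSystem T)

/-- `g` lists neighbors and colors at the vertices beyond `d` as prescribed by a colored tree: at a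
leaf, the parent, the previous leaf and the next leaf; at any other vertex, the parent and the two
children. The outer neighbors, and the colors of the edges to them, are `P`, `L` and `N`. -/
def Follows (g : V → Fin 3 → V × K) : ColTree K → T.Dart → V × K → V × K → V × K → Prop
  | .leaf, d, P, L, N => g d.snd = ![P, L, N]
  | .node a b m t₁ t₂, d, P, L, N =>
    g d.snd = ![P, ((R.left d).snd, a), ((R.right d).snd, b)] ∧
    Follows g t₁ (R.left d) (d.snd, a) L ((R.firstLeaf t₂.shape (R.right d)).snd, m) ∧
    Follows g t₂ (R.right d) (d.snd, b) ((R.lastLeaf t₁.shape (R.left d)).snd, m) N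

variable {R} {g g' : V → Fin 3 → V × K} {t : ColTree K} {d : T.Dart} {P L N : V × K}

theorem Follows.congr [Finite V] (hT : T.IsCubicTree) (hd : R.Spans t.shape d)
    (h : R.Follows g t d P L N) (hg : ∀ v ∈ d.beyond, g v = g' v) : R.Follows g' t d P L N := by
  induction t generalizing d P L N with
  | leaf => exact (hg _ d.snd_mem_beyond).symm.trans h
  | node a b m t₁ t₂ ih₁ ih₂ =>
    have e := beyond_eq (R := R) hT hd.1
    exact ⟨(hg _ d.snd_mem_beyond).symm.trans h.1,
      ih₁ hd.2.1 h.2.1 fun v hv => hg v (e ▸ .inr (.inl hv)),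
      ih₂ hd.2.2 h.2.2 fun v hv => hg v (e ▸ .inr (.inr hv))⟩

/-- The lists for the two children prescribe values on disjoint vertex sets that omit `d.snd`, so
they can be merged. -/
theorem exists_follows [Finite V] (hT : T.IsCubicTree) (hd : R.Spans t.shape d) (P L N : V × K) :
    ∃ g, R.Follows g t d P L N := by
  classical
  induction t generalizing d P L N with
  | leaf => exact ⟨fun _ => ![P, L, N], rfl⟩
  | node a b m t₁ t₂ ih₁ ih₂ =>
    obtain ⟨g₁, h₁⟩ := ih₁ hd.2.1 (d.snd, a) L ((R.firstLeaf t₂.shape (R.right d)).snd, m)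
    obtain ⟨g₂, h₂⟩ := ih₂ hd.2.2 (d.snd, b) ((R.lastLeaf t₁.shape (R.left d)).snd, m) N
    refine ⟨fun v => if v = d.snd then ![P, ((R.left d).snd, a), ((R.right d).snd, b)]
      else if v ∈ (R.left d).beyond then g₁ v else g₂ v, if_pos rfl,
      h₁.congr hT hd.2.1 fun v hv => ?_, h₂.congr hT hd.2.2 fun v hv => ?_⟩
    · have : v ≠ d.snd := fun h => snd_notMem_beyond_left (R := R) d (h ▸ hv)
      simp [this, hv]
    · have : v ≠ d.snd := fun h => snd_notMem_beyond_right (R := R) d (h ▸ hv)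
      have h' := Set.disjoint_right.1 (disjoint_beyond hT hd.1) hv
      simp [this, h']

theorem Follows.apply_zero (h : R.Follows g t d P L N) : g d.snd 0 = P := by
  cases t with
  | leaf => rw [Follows] at h; rw [h]; rfl
  | node => rw [h.1]; rfl

theorem Follows.apply_one (hd : R.Spans t.shape d) (h : R.Follows g t d P L N) :
    g (R.firstLeaf t.shape d).snd 1 = L := by
  induction t generalizing d P L N with
  | leaf => rw [Follows] at h; exact congrFun h 1
  | node a b m t₁ t₂ ih₁ ih₂ => exact ih₁ hd.2.1 h.2.1

theorem Follows.apply_two (hd : R.Spans t.shape d) (h : R.Follows g t d P L N) :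
    g (R.lastLeaf t.shape d).snd 2 = N := by
  induction t generalizing d P L N with
  | leaf => rw [Follows] at h; exact congrFun h 2
  | node a b m t₁ t₂ ih₁ ih₂ => exact ih₂ hd.2.2 h.2.2

theorem Follows.rootColors (h : R.Follows g t d P L N) (c : K) (hc : FarColor g d.snd P.1 c) :
    c ∈ t.rootColors L.2 N.2 := by
  cases t with
  | leaf => exact hc.mem_of_fst h
  | node => exact hc.mem_of_fst h.1

theorem Follows.leftColors (h : R.Follows g t d P L N) (c : K)
    (hc : FarColor g (R.firstLeaf t.shape d).snd L.1 c) : c ∈ t.leftColors P.2 N.2 := by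
  induction t generalizing d P L N with
  | leaf => exact hc.mem_of_snd h
  | node a b m t₁ t₂ ih₁ ih₂ => exact ih₁ h.2.1 hc

theorem Follows.rightColors (h : R.Follows g t d P L N) (c : K)
    (hc : FarColor g (R.lastLeaf t.shape d).snd N.1 c) : c ∈ t.rightColors P.2 L.2 := by
  induction t generalizing d P L N with
  | leaf => exact hc.mem_of_trd h
  | node a b m t₁ t₂ ih₁ ih₂ => exact ih₂ h.2.2 hc

theorem Follows.starAt [Finite V] (hT : T.IsCubicTree) (hd : R.Spans t.shape d)
    (h : R.Follows g t d P L N) {A B C : List K} (ht : t.Valid A B C P.2 L.2 N.2)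
    (hA : ∀ c, FarColor g P.1 d.snd c → c ∈ A)
    (hB : ∀ c, FarColor g L.1 (R.firstLeaf t.shape d).snd c → c ∈ B)
    (hC : ∀ c, FarColor g N.1 (R.lastLeaf t.shape d).snd c → c ∈ C) :
    ∀ v ∈ d.beyond, StarAt g v := by
  induction t generalizing d P L N A B C with
  | leaf =>
    rw [Dart.beyond_eq_singleton hd]
    rintro v rfl
    exact starAt_of_vertexOK h ht hA hB hC
  | node a b m t₁ t₂ ih₁ ih₂ =>
    rw [beyond_eq hT hd.1]
    rintro v (rfl | hv | hv)
    · exact starAt_of_vertexOK h.1 ht.1 hA h.2.1.rootColors h.2.2.rootColors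
    · exact ih₁ hd.2.1 h.2.1 ht.2.1 (fun c hc => hc.mem_of_snd h.1) hB h.2.2.leftColors v hv
    · exact ih₂ hd.2.2 h.2.2 ht.2.2 (fun c hc => hc.mem_of_trd h.1) h.2.1.rightColors hC v hv

theorem Follows.symmAt [Finite V] (hT : T.IsCubicTree) (hd : R.Spans t.shape d)
    (h : R.Follows g t d P L N) (hP : ∃ j, g P.1 j = (d.snd, P.2))
    (hL : ∃ j, g L.1 j = ((R.firstLeaf t.shape d).snd, L.2))
    (hN : ∃ j, g N.1 j = ((R.lastLeaf t.shape d).snd, N.2)) : ∀ v ∈ d.beyond, SymmAt g v := by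
  induction t generalizing d P L N with
  | leaf =>
    rw [Dart.beyond_eq_singleton hd]
    rintro v rfl i
    rw [Follows] at h
    rw [h]
    fin_cases i
    exacts [hP, hL, hN]
  | node a b m t₁ t₂ ih₁ ih₂ =>
    rw [beyond_eq hT hd.1]
    rintro v (rfl | hv | hv)
    · intro i
      rw [h.1]
      fin_cases i
      exacts [hP, ⟨0, h.2.1.apply_zero⟩, ⟨0, h.2.2.apply_zero⟩]
    · exact ih₁ hd.2.1 h.2.1 ⟨1, congrFun h.1 1⟩ hL ⟨1, h.2.2.apply_one hd.2.2⟩ v hv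
    · exact ih₂ hd.2.2 h.2.2 ⟨2, congrFun h.1 2⟩ ⟨2, h.2.1.apply_two hd.2.1⟩ hN v hv

/-- `g` lists all neighbors of `v` in the tree, and the leaves next to `v` if `v` is a leaf. -/
def ListsAt (R : RotationSystem T) (g : V → Fin 3 → V × K) (v : V) : Prop :=
  (∀ w, T.Adj v w → ∃ i, (g v i).1 = w) ∧
    (T.IsLeaf v → R.IsNextLeaf (g v 1).1 v ∧ R.IsNextLeaf v (g v 2).1)

theorem Follows.listsAt [Finite V] (hT : T.IsCubicTree) (hd : R.Spans t.shape d)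
    (h : R.Follows g t d P L N) (hP : P.1 = d.fst)
    (hL : R.IsNextLeaf L.1 (R.firstLeaf t.shape d).snd)
    (hN : R.IsNextLeaf (R.lastLeaf t.shape d).snd N.1) : ∀ v ∈ d.beyond, ListsAt R g v := by
  induction t generalizing d P L N with
  | leaf =>
    rw [Dart.beyond_eq_singleton hd]
    rw [Follows] at h
    rintro v rfl
    refine ⟨fun w hw => ⟨0, ?_⟩, fun _ => ?_⟩
    · rw [h]
      exact hP.trans (congrArg (fun e : T.Dart => e.snd)
        (IsLeaf.dart_unique (d := d.symm) (e := ⟨(d.snd, w), hw⟩) hd rfl))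
    · rw [h]
      exact ⟨hL, hN⟩
  | node a b m t₁ t₂ ih₁ ih₂ =>
    rw [beyond_eq hT hd.1]
    have hn := Spans.isNextLeaf hT (t₁ := t₁.shape) (t₂ := t₂.shape) hd
    rintro v (rfl | hv | hv)
    · refine ⟨fun w hw => ?_, fun hl => absurd hl hd.1⟩
      rw [h.1]
      rcases (rot_facts (R := R) hT hd.1).2.2.2.2 ⟨(d.snd, w), hw⟩ rfl with e | e | e
      · exact ⟨0, hP.trans (congrArg (fun e : T.Dart => e.snd) e).symm⟩
      · exact ⟨1, (congrArg (fun e : T.Dart => e.snd) e).symm⟩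
      · exact ⟨2, (congrArg (fun e : T.Dart => e.snd) e).symm⟩
    · exact ih₁ hd.2.1 h.2.1 (fst_left R d).symm hL hn v hv
    · exact ih₂ hd.2.2 h.2.2 (fst_right R d).symm hn hN v hv

end RotationSystem

end SimpleGraph

/-! ### The upper bound -/

namespace HalinColoring

theorem VertexOK.swap {K : Type*} {x y z : K} {X Y Z : List K} (h : VertexOK x y z X Y Z) :
    VertexOK x z y X Z Y :=
  ⟨⟨h.1.2.1, h.1.1, h.1.2.2.symm⟩, h.2.2.1, h.2.1, fun e => h.2.2.2 e.symm⟩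

end HalinColoring

namespace SimpleGraph

open HalinColoring RotationSystem

theorem IsLeaf.eq_fst_or_mem_beyond {V : Type*} {T : SimpleGraph V} (hT : T.Connected)
    {d : T.Dart} (hd : T.IsLeaf d.fst) (v : V) : v = d.fst ∨ v ∈ d.beyond := by
  obtain ⟨p, hp⟩ := hT.exists_isPath d.fst v
  cases p with
  | nil => exact .inl rfl
  | @cons _ u _ hu q =>
    rw [Walk.cons_isPath_iff] at hp
    have : d = ⟨(d.fst, u), hu⟩ := hd.dart_unique rfl
    rw [this]
    exact .inr ⟨q, hp⟩

theorem IsHalin.exists_isStar {V : Type*} [Fintype V] {G : SimpleGraph V} [DecidableRel G.Adj]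
    (hG : G.IsHalin) (h3 : G.IsRegularOfDegree 3) : ∃ f : G.EdgeLabeling (Fin 6), f.IsStar := by
  classical
  obtain ⟨h4, T, R, htree, -, rfl⟩ := hG
  have hadj_iff : ∀ v w, (T ⊔ R.leafCycle).Adj v w ↔
      T.Adj v w ∨ v ≠ w ∧ (R.IsNextLeaf v w ∨ R.IsNextLeaf w v) := fun v w => Iff.rfl
  have hT : T.IsCubicTree := by
    refine ⟨htree, fun v hv => ?_⟩
    -- The leaf cycle adds no edge at a vertex that is not a leaf.
    have : T.neighborSet v = (T ⊔ R.leafCycle).neighborSet v := by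
      ext w
      rw [mem_neighborSet, mem_neighborSet, hadj_iff]
      exact ⟨.inl, fun h => h.elim id fun h => h.2.elim (fun h => absurd h.1 hv)
        fun h => absurd h.2.1 hv⟩
    rw [this, ← h3 v, ← card_neighborSet_eq_degree, Set.ncard_eq_toFinset_card',
      Set.toFinset_card]
  rw [Nat.card_eq_fintype_card] at h4
  have : Nontrivial V := Fintype.one_lt_card_iff_nontrivial.1 (by omega)
  obtain ⟨x, hx⟩ := htree.exists_vert_degree_one_of_nontrivial
  have hxl : T.IsLeaf x := by
    rw [IsLeaf, Set.ncard_eq_toFinset_card', Set.toFinset_card, card_neighborSet_eq_degree, hx]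
  obtain ⟨y, hy⟩ := Set.ncard_eq_one.1 hxl
  have hxy : T.Adj x y := by
    rw [← mem_neighborSet, hy]; rfl
  let d : T.Dart := ⟨(x, y), hxy⟩
  have hcover : ∀ v, v = x ∨ v ∈ d.beyond :=
    IsLeaf.eq_fst_or_mem_beyond (d := d) htree.connected hxl
  have hxd : x ∉ d.beyond := d.fst_notMem_beyond
  obtain ⟨s, hs⟩ := R.exists_spans hT d
  cases s with
  | leaf =>
    exfalso
    have h2 : (Finset.univ : Finset V) ⊆ {x, y} := fun v _ => by
      rcases hcover v with h | h
      · simp [h]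
      · rw [Dart.beyond_eq_singleton hs] at h
        simp [show v = y from h]
    have := (Finset.card_le_card h2).trans Finset.card_le_two
    rw [Finset.card_univ] at this
    omega
  | node t₁ t₂ =>
  obtain ⟨t, p, l, r, ht, hv, hok⟩ := exists_valid t₁ t₂
  rw [← ht] at hs
  clear ht
  obtain ⟨g₀, hg₀⟩ := exists_follows hT hs (x, p) (x, l) (x, r)
  let a := (R.firstLeaf t.shape d).snd
  let b := (R.lastLeaf t.shape d).snd
  -- As at every leaf: parent, previous leaf, next leaf. The edge that leaves the last leaf `b`
  -- enters `x`, so `r` precedes `l`.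
  let g : V → Fin 3 → V × Fin 6 := fun v => if v = x then ![(y, p), (b, r), (a, l)] else g₀ v
  have hgx : g x = ![(y, p), (b, r), (a, l)] := if_pos rfl
  have hg : R.Follows g t d (x, p) (x, l) (x, r) :=
    hg₀.congr hT hs fun v hv => (if_neg fun h : v = x => hxd (h ▸ hv)).symm
  have hxa : R.IsNextLeaf x a := hs.run_firstLeaf.isNextLeaf hxl hs.isLeaf_firstLeaf
  have hbx : R.IsNextLeaf b x := (hs.run_lastLeaf hT).isNextLeaf hs.isLeaf_lastLeaf hxl
  have hlists : ∀ v, ListsAt R g v := by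
    intro v
    rcases hcover v with rfl | h
    · refine ⟨fun w hw => ⟨0, ?_⟩, fun _ => ?_⟩
      · rw [hgx]
        exact (show w = y by rwa [← mem_neighborSet, hy] at hw).symm
      · rw [hgx]
        exact ⟨hbx, hxa⟩
    · exact hg.listsAt hT hs rfl hxa hbx v h
  -- Next and previous leaves are unique, so the lists contain all cycle neighbors. Since the degree
  -- is 3, the three entries are then distinct and are exactly the neighbors.
  have hsub : ∀ v w, (T ⊔ R.leafCycle).Adj v w → ∃ i, (g v i).1 = w := by
    intro v w h
    rcases (hadj_iff v w).1 h with h | ⟨-, h | h⟩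
    · exact (hlists v).1 w h
    · exact ⟨2, ((hlists v).2 h.1).2.right_unique h⟩
    · exact ⟨1, ((hlists v).2 h.2.1).1.left_unique h⟩
  have hle : ∀ v, (T ⊔ R.leafCycle).neighborFinset v ⊆ Finset.univ.image fun i => (g v i).1 := by
    intro v w hw
    obtain ⟨i, hi⟩ := hsub v w ((mem_neighborFinset _ _ _).1 hw)
    exact Finset.mem_image.2 ⟨i, Finset.mem_univ _, hi⟩
  have hcard : ∀ v, 3 ≤ (Finset.univ.image fun i => (g v i).1).card := fun v => by
    have := Finset.card_le_card (hle v)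
    rwa [card_neighborFinset_eq_degree, h3 v] at this
  refine SimpleGraph.exists_isStar g (fun v w => ⟨hsub v w, ?_⟩) ?_ ?_ ?_
  · rintro ⟨i, rfl⟩
    rw [← mem_neighborFinset, Finset.eq_of_subset_of_card_le (hle v)]
    · exact Finset.mem_image_of_mem _ (Finset.mem_univ i)
    · rw [card_neighborFinset_eq_degree, h3 v]
      exact Finset.card_image_le
  · intro v i k h
    have hc : (Finset.univ.image fun i => (g v i).1).card = (Finset.univ : Finset (Fin 3)).card :=
      le_antisymm Finset.card_image_le (hcard v)
    exact Finset.injOn_of_card_image_eq hc (Finset.mem_coe.2 (Finset.mem_univ i))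
      (Finset.mem_coe.2 (Finset.mem_univ k)) h
  · intro v
    rcases hcover v with rfl | h
    · intro i
      rw [hgx]
      fin_cases i
      exacts [⟨0, hg.apply_zero⟩, ⟨2, hg.apply_two hs⟩, ⟨1, hg.apply_one hs⟩]
    · exact hg.symmAt hT hs ⟨0, congrFun hgx 0⟩ ⟨2, congrFun hgx 2⟩ ⟨1, congrFun hgx 1⟩ v h
  · intro v
    rcases hcover v with rfl | h
    · exact starAt_of_vertexOK hgx hok.swap hg.rootColors hg.rightColors hg.leftColors
    · refine hg.starAt hT hs hv (fun c hc => ?_) (fun c hc => ?_) (fun c hc => ?_) v h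
      · exact (List.Perm.swap _ _ _).subset (hc.mem_of_fst hgx)
      · exact hc.mem_of_trd hgx
      · exact hc.mem_of_snd hgx

theorem starChromaticIndex_le {V : Type*} {G : SimpleGraph V} {n : ℕ} {f : G.EdgeLabeling (Fin n)}
    (hf : f.IsStar) : G.starChromaticIndex ≤ n :=
  iInf₂_le n ⟨f, hf⟩

end SimpleGraph

/-! ### Sharpness: the prism -/

namespace SimpleGraph

/-- The case `v₄ = v₀` is allowed, so that 4-cycles and paths are treated together. -/
theorem EdgeLabeling.IsStar.not_alternating {V K : Type*} {G : SimpleGraph V}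
    {f : G.EdgeLabeling K} (hf : f.IsStar) {v₀ v₁ v₂ v₃ v₄ : V} (h₁ : G.Adj v₀ v₁)
    (h₂ : G.Adj v₁ v₂) (h₃ : G.Adj v₂ v₃) (h₄ : G.Adj v₃ v₄) (hne : [v₀, v₁, v₂, v₃].Nodup)
    (hne' : v₄ ∉ [v₁, v₂, v₃]) :
    ¬ (f ⟨s(v₀, v₁), h₁⟩ = f ⟨s(v₂, v₃), h₃⟩ ∧ f ⟨s(v₁, v₂), h₂⟩ = f ⟨s(v₃, v₄), h₄⟩) := by
  rintro ⟨e₁, e₂⟩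
  have two : f.IsTwoColored (.cons h₁ (.cons h₂ (.cons h₃ (.cons h₄ .nil)))) := by
    refine ⟨f ⟨s(v₀, v₁), h₁⟩, f ⟨s(v₁, v₂), h₂⟩, ?_⟩
    rintro ⟨e, he⟩ hmem
    simp only [Walk.edges_cons, Walk.edges_nil, List.mem_cons, List.not_mem_nil, or_false] at hmem
    rcases hmem with rfl | rfl | rfl | rfl
    exacts [.inl rfl, .inr rfl, .inl e₁.symm, .inr e₂.symm]
  by_cases h : v₀ = v₄
  · subst h
    refine hf.cycle _ _ ?_ rfl two
    simp only [Walk.cons_isCycle_iff, Walk.cons_isPath_iff, Walk.support_cons, Walk.support_nil,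
      Walk.edges_cons, Walk.edges_nil, Walk.IsPath.nil, List.mem_cons, List.nodup_cons,
      Sym2.eq_iff] at hne hne' ⊢
    grind
  · refine hf.path _ _ _ ?_ rfl two
    simp only [Walk.cons_isPath_iff, Walk.support_cons, Walk.support_nil, Walk.IsPath.nil,
      List.mem_cons, List.nodup_cons] at hne hne' ⊢
    grind

set_option synthInstance.maxHeartbeats 400000 in
set_option synthInstance.maxSize 2000 in
/-- The star coloring problem with five colors for the prism, with one color for each edge. -/
theorem not_five_colors :
    ∀ e₀ : Fin 5,
    ∀ e₁ : Fin 5,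
      e₀ ≠ e₁ →
    ∀ e₂ : Fin 5,
      e₀ ≠ e₂ ∧ e₁ ≠ e₂ →
    ∀ e₃ : Fin 5,
      e₀ ≠ e₃ ∧ e₂ ≠ e₃ →
    ∀ e₄ : Fin 5,
      e₀ ≠ e₄ ∧ e₁ ≠ e₄ →
    ∀ e₅ : Fin 5,
      e₁ ≠ e₅ ∧ e₂ ≠ e₅ ∧ ¬ (e₅ = e₀ ∧ e₂ = e₄) →
    ∀ e₆ : Fin 5,
      e₃ ≠ e₆ ∧ e₄ ≠ e₆ ∧ ¬ (e₅ = e₄ ∧ e₁ = e₆) ∧ ¬ (e₁ = e₃ ∧ e₂ = e₆) ∧ ¬ (e₄ = e₃ ∧ e₆ = e₂) ∧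
      ¬ (e₀ = e₆ ∧ e₄ = e₃) ∧ ¬ (e₅ = e₃ ∧ e₂ = e₆) ∧ ¬ (e₆ = e₀ ∧ e₄ = e₂) ∧ ¬ (e₁ = e₃ ∧ e₀ = e₆) →
    ∀ e₇ : Fin 5,
      e₃ ≠ e₇ ∧ e₅ ≠ e₇ ∧ e₆ ≠ e₇ ∧ ¬ (e₇ = e₂ ∧ e₃ = e₁) ∧ ¬ (e₇ = e₀ ∧ e₃ = e₁) ∧
      ¬ (e₀ = e₅ ∧ e₂ = e₇) ∧ ¬ (e₇ = e₄ ∧ e₆ = e₁) ∧ ¬ (e₇ = e₁ ∧ e₅ = e₄) ∧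
      ¬ (e₃ = e₅ ∧ e₇ = e₂) ∧ ¬ (e₁ = e₇ ∧ e₅ = e₆) ∧ ¬ (e₇ = e₀ ∧ e₃ = e₄) ∧
      ¬ (e₀ = e₇ ∧ e₃ = e₅) ∧ ¬ (e₄ = e₇ ∧ e₆ = e₅) →
    ∀ e₈ : Fin 5,
      e₄ ≠ e₈ ∧ e₅ ≠ e₈ ∧ e₆ ≠ e₈ ∧ e₇ ≠ e₈ ∧ ¬ (e₈ = e₀ ∧ e₄ = e₂) ∧ ¬ (e₈ = e₃ ∧ e₆ = e₂) ∧
      ¬ (e₁ = e₈ ∧ e₅ = e₆) ∧ ¬ (e₂ = e₇ ∧ e₃ = e₈) ∧ ¬ (e₇ = e₄ ∧ e₈ = e₁) ∧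
      ¬ (e₀ = e₇ ∧ e₃ = e₈) ∧ ¬ (e₀ = e₅ ∧ e₂ = e₈) ∧ ¬ (e₈ = e₀ ∧ e₄ = e₃) ∧
      ¬ (e₅ = e₄ ∧ e₁ = e₈) ∧ ¬ (e₃ = e₅ ∧ e₂ = e₈) →
    False := by decide +kernel

theorem six_le_of_isStar {n : ℕ} {f : (cycleGraph 6)ᶜ.EdgeLabeling (Fin n)} (hf : f.IsStar) :
    6 ≤ n := by
  by_contra! hn
  -- The value 0 at non-adjacent pairs is never used. In `C` the ends are sorted so that `C u v` and
  -- `C v u` agree by evaluation.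
  let F : Fin 6 → Fin 6 → Fin 5 := fun u v =>
    if h : (cycleGraph 6)ᶜ.Adj u v then (f ⟨s(u, v), h⟩).castLE (by omega) else 0
  let C : Fin 6 → Fin 6 → Fin 5 := fun u v => F (min u v) (max u v)
  have hC : ∀ {u v} (h : (cycleGraph 6)ᶜ.Adj u v),
      C u v = (f ⟨s(u, v), h⟩).castLE (by omega) := by
    intro u v h
    rcases le_total u v with huv | huv
    · simp only [C, F, min_eq_left huv, max_eq_right huv, dif_pos h]
    · simp only [C, F, min_eq_right huv, max_eq_left huv, dif_pos h.symm, Sym2.eq_swap]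
  have hp : ∀ u v w, (cycleGraph 6)ᶜ.Adj u v ∧ (cycleGraph 6)ᶜ.Adj v w ∧ u ≠ w →
      C u v ≠ C v w := by
    rintro u v w ⟨h₁, h₂, h₃⟩
    rw [hC h₁, hC h₂, (Fin.castLE_injective _).ne_iff]
    exact hf.proper _ _ (fun h => h₃ (by have := Sym2.eq_iff.1 (congrArg Subtype.val h); grind))
      ⟨v, by simp, by simp⟩
  have ha : ∀ v₀ v₁ v₂ v₃ v₄, ((cycleGraph 6)ᶜ.Adj v₀ v₁ ∧ (cycleGraph 6)ᶜ.Adj v₁ v₂ ∧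
      (cycleGraph 6)ᶜ.Adj v₂ v₃ ∧ (cycleGraph 6)ᶜ.Adj v₃ v₄) ∧ [v₀, v₁, v₂, v₃].Nodup ∧
      v₄ ∉ [v₁, v₂, v₃] → ¬ (C v₀ v₁ = C v₂ v₃ ∧ C v₁ v₂ = C v₃ v₄) := by
    rintro v₀ v₁ v₂ v₃ v₄ ⟨⟨h₁, h₂, h₃, h₄⟩, h₅, h₆⟩
    rw [hC h₁, hC h₂, hC h₃, hC h₄, (Fin.castLE_injective _).eq_iff,
      (Fin.castLE_injective _).eq_iff]
    exact hf.not_alternating h₁ h₂ h₃ h₄ h₅ h₆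
  -- The order is triangle 0-2-4, the three edges between the triangles, triangle 1-3-5. Each
  -- constraint comes with the last of its edges, so that the search prunes early.
  exact not_five_colors
    (C 0 2)
    (C 2 4) (hp 0 2 4 (by decide))
    (C 0 4)
      ⟨hp 2 0 4 (by decide), hp 2 4 0 (by decide)⟩
    (C 0 3)
      ⟨hp 2 0 3 (by decide), hp 4 0 3 (by decide)⟩
    (C 2 5)
      ⟨hp 0 2 5 (by decide), hp 4 2 5 (by decide)⟩
    (C 1 4)
      ⟨hp 2 4 1 (by decide), hp 0 4 1 (by decide), ha 1 4 0 2 5 (by decide)⟩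
    (C 3 5)
      ⟨hp 0 3 5 (by decide), hp 2 5 3 (by decide), ha 1 4 2 5 3 (by decide),
      ha 2 4 0 3 5 (by decide), ha 2 5 3 0 4 (by decide), ha 0 2 5 3 0 (by decide),
      ha 1 4 0 3 5 (by decide), ha 3 5 2 0 4 (by decide), ha 4 2 0 3 5 (by decide)⟩
    (C 1 3)
      ⟨hp 0 3 1 (by decide), hp 4 1 3 (by decide), hp 5 3 1 (by decide), ha 1 3 0 4 2 (by decide),
      ha 1 3 0 2 4 (by decide), ha 2 0 4 1 3 (by decide), ha 1 3 5 2 4 (by decide),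
      ha 3 1 4 2 5 (by decide), ha 0 3 1 4 0 (by decide), ha 2 4 1 3 5 (by decide),
      ha 1 3 0 2 5 (by decide), ha 2 0 3 1 4 (by decide), ha 2 5 3 1 4 (by decide)⟩
    (C 1 5)
      ⟨hp 2 5 1 (by decide), hp 4 1 5 (by decide), hp 3 5 1 (by decide), hp 3 1 5 (by decide),
      ha 1 5 2 0 4 (by decide), ha 1 5 3 0 4 (by decide), ha 2 4 1 5 3 (by decide),
      ha 4 0 3 1 5 (by decide), ha 3 1 5 2 4 (by decide), ha 2 0 3 1 5 (by decide),
      ha 2 0 4 1 5 (by decide), ha 1 5 2 0 3 (by decide), ha 1 4 2 5 1 (by decide),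
      ha 3 0 4 1 5 (by decide)⟩

/-- The spanning tree of the prism without the edges of a 4-cycle. -/
def prismTree : SimpleGraph (Fin 6) :=
  fromRel fun i j => j = ![0, 3, 0, 0, 0, 3] i

instance : DecidableRel prismTree.Adj := fun i j =>
  inferInstanceAs (Decidable (i ≠ j ∧ (_ ∨ _)))

theorem isTree_prismTree : prismTree.IsTree := by
  rw [isTree_iff_connected_and_card]
  constructor
  · have h : ∀ v, prismTree.Reachable v 0 := by
      have h3 : prismTree.Reachable 3 0 := Adj.reachable (by decide)
      intro v
      fin_cases v
      · exact .refl _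
      · exact (Adj.reachable (by decide : prismTree.Adj 1 3)).trans h3
      · exact Adj.reachable (by decide)
      · exact h3
      · exact Adj.reachable (by decide)
      · exact (Adj.reachable (by decide : prismTree.Adj 5 3)).trans h3
    exact ⟨fun u v => (h u).trans (h v).symm⟩
  · rw [Nat.card_eq_fintype_card, Nat.card_eq_fintype_card]
    decide +kernel

theorem isLeaf_prismTree_iff {v : Fin 6} : prismTree.IsLeaf v ↔ v ≠ 0 ∧ v ≠ 3 := by
  rw [IsLeaf, Set.ncard_eq_toFinset_card']
  revert v
  decide +kernel

/-- The neighbor of `v` that follows the neighbor `w` in the plane embedding of `prismTree`. -/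
def prismNext (v w : Fin 6) : Fin 6 :=
  if v = 0 then ![0, 1, 4, 2, 3, 5] w else if v = 3 then ![1, 5, 2, 3, 4, 0] w else w

/-- A plane embedding of `prismTree`. -/
def prismRotation : RotationSystem prismTree where
  rot :=
    { toFun := fun d => ⟨(d.fst, prismNext d.fst d.snd),
        (by decide : ∀ v w, prismTree.Adj v w → prismTree.Adj v (prismNext v w)) _ _ d.adj⟩
      -- The rotation has order 3 at the inner vertices 0 and 3 and is trivial at leaves, so its
      -- square is its inverse.
      invFun := fun d => ⟨(d.fst, prismNext d.fst (prismNext d.fst d.snd)),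
        (by decide : ∀ v w, prismTree.Adj v w → prismTree.Adj v (prismNext v (prismNext v w)))
          _ _ d.adj⟩
      left_inv := fun d => Dart.ext_of_fst_snd rfl ((by decide : ∀ v w, prismTree.Adj v w →
        prismNext v (prismNext v (prismNext v w)) = w) _ _ d.adj)
      right_inv := fun d => Dart.ext_of_fst_snd rfl ((by decide : ∀ v w, prismTree.Adj v w →
        prismNext v (prismNext v (prismNext v w)) = w) _ _ d.adj) }
  fst_rot _ := rfl
  sameCycle := by
    rintro ⟨⟨v, w⟩, hw⟩ ⟨⟨v', w'⟩, hw'⟩ (rfl : v = v')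
    rcases (by decide : ∀ v w w', prismTree.Adj v w → prismTree.Adj v w' →
      w' = w ∨ w' = prismNext v w ∨ w' = prismNext v (prismNext v w)) v w w' hw hw'
      with rfl | rfl | rfl
    exacts [⟨0, rfl⟩, ⟨1, rfl⟩, ⟨2, rfl⟩]

theorem isNextLeaf_prismRotation_iff {x y : Fin 6} : prismRotation.IsNextLeaf x y ↔
    (x, y) ∈ [((2 : Fin 6), (4 : Fin 6)), (4, 1), (1, 5), (5, 2)] := by
  have key : ∀ (x y : Fin 6) (d : prismTree.Dart) (n : ℕ), (x ≠ 0 ∧ x ≠ 3) → (y ≠ 0 ∧ y ≠ 3) →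
      d.fst = x → (prismRotation.faceStep^[n] d).snd = y →
      (∀ i < n, ¬ ((prismRotation.faceStep^[i] d).snd ≠ 0 ∧
        (prismRotation.faceStep^[i] d).snd ≠ 3)) → prismRotation.IsNextLeaf x y := by
    intro x y d n hx hy hd hn h
    exact ⟨isLeaf_prismTree_iff.2 hx, isLeaf_prismTree_iff.2 hy, d, n, hd, hn,
      fun i hi hl => h i hi (isLeaf_prismTree_iff.1 hl)⟩
  have h₂ := key 2 4 ⟨(2, 0), by decide⟩ 1 (by decide) (by decide) rfl rfl (by decide)
  have h₄ := key 4 1 ⟨(4, 0), by decide⟩ 2 (by decide) (by decide) rfl rfl (by decide)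
  have h₁ := key 1 5 ⟨(1, 3), by decide⟩ 1 (by decide) (by decide) rfl rfl (by decide)
  have h₅ := key 5 2 ⟨(5, 3), by decide⟩ 2 (by decide) (by decide) rfl rfl (by decide)
  constructor
  · intro h
    have hx := isLeaf_prismTree_iff.1 h.1
    fin_cases x
    · exact absurd rfl hx.1
    · rw [h.right_unique h₁]; decide
    · rw [h.right_unique h₂]; decide
    · exact absurd rfl hx.2
    · rw [h.right_unique h₄]; decide
    · rw [h.right_unique h₅]; decide
  · simp only [List.mem_cons, List.not_mem_nil, or_false, Prod.mk.injEq]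
    rintro (⟨rfl, rfl⟩ | ⟨rfl, rfl⟩ | ⟨rfl, rfl⟩ | ⟨rfl, rfl⟩) <;> assumption

theorem isHalin_compl_cycleGraph_six : (cycleGraph 6)ᶜ.IsHalin := by
  refine ⟨by simp, prismTree, prismRotation, isTree_prismTree, fun v => ?_, ?_⟩
  · rw [Set.ncard_eq_toFinset_card']
    revert v
    decide +kernel
  · ext x y
    have : (prismTree ⊔ prismRotation.leafCycle).Adj x y ↔ prismTree.Adj x y ∨
        x ≠ y ∧ (prismRotation.IsNextLeaf x y ∨ prismRotation.IsNextLeaf y x) := Iff.rfl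
    rw [this, isNextLeaf_prismRotation_iff, isNextLeaf_prismRotation_iff]
    clear this
    revert x y
    decide +kernel

theorem isRegularOfDegree_compl_cycleGraph_six : (cycleGraph 6)ᶜ.IsRegularOfDegree 3 := by
  change ∀ v, (cycleGraph 6)ᶜ.degree v = 3
  decide +kernel

theorem starChromaticIndex_compl_cycleGraph_six : (cycleGraph 6)ᶜ.starChromaticIndex = 6 := by
  refine le_antisymm ?_ (le_iInf₂ fun n ⟨f, hf⟩ => ?_)
  · obtain ⟨f, hf⟩ := isHalin_compl_cycleGraph_six.exists_isStar
      isRegularOfDegree_compl_cycleGraph_six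
    exact starChromaticIndex_le hf
  · exact_mod_cast six_le_of_isStar hf

end SimpleGraph

theorem mainTheorem4 :
    (∀ {V : Type*} [Fintype V] (G : SimpleGraph V) [DecidableRel G.Adj],
      G.IsHalin → G.IsRegularOfDegree 3 → G.starChromaticIndex ≤ 6) ∧
    ((SimpleGraph.cycleGraph 6)ᶜ.IsHalin ∧ (SimpleGraph.cycleGraph 6)ᶜ.IsRegularOfDegree 3 ∧
      (SimpleGraph.cycleGraph 6)ᶜ.starChromaticIndex = 6) := by
  refine ⟨fun G _ hG h3 => ?_, SimpleGraph.isHalin_compl_cycleGraph_six,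
    SimpleGraph.isRegularOfDegree_compl_cycleGraph_six,
    SimpleGraph.starChromaticIndex_compl_cycleGraph_six⟩
  obtain ⟨f, hf⟩ := hG.exists_isStar h3
  exact SimpleGraph.starChromaticIndex_le hf
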